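/- Let $N\in\mathbb N$ and $1<p<N$ ($p$ real). Let $V:(0,\infty)\to[0,+\infty]$ be measurable with $V\in L^1((r_1,r_2))$ for some $r_2>r_1>0$, and let $K:(0,\infty)\to(0,\infty)$ be measurable with $K\in L^s_{\mathrm{loc}}((0,\infty))$ for some $s>1$. Let $D^{1,p}(\mathbb R^N)=\{u\in L^{p^*}(\mathbb R^N):\nabla u\in L^p(\mathbb R^N)\}$ (weak gradient, $p^*=pN/(N-p)$), let $$W=\Big\{u\in D^{1,p}(\mathbb R^N):\int_{\mathbb R^N}V(|x|)|u|^p\,dx<\infty\Big\},\qquad \|u\|^p=\int_{\mathbb R^N}\big(|\nabla u|^p+V(|x|)|u|^p\big)\,dx,$$ let $W_r$ be the subspace of radial functions in $W$, and for $q>1$, $R>0$ put $$\mathcal R_\infty(q,R)=\sup_{u\in W_r,\ h\in W,\ \|u\|=\|h\|=1}\ \int_{\{|x|\ge R\}}K(|x|)\,|u|^{q-1}|h|\,dx\in[0,+\infty].$$ Assume that for some $R_2>0$, $\alpha_\infty\in\mathbb R$, $0\le\beta_\infty\le1$ and $\gamma_\infty\le p$ one has $V(r)<+\infty$ for almost every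 $r>R_2$, $$\operatorname*{ess\,sup}_{r>R_2}\frac{K(r)}{r^{\alpha_\infty}V(r)^{\beta_\infty}}<+\infty\qquad\text{and}\qquad \operatorname*{ess\,inf}_{r>R_2}r^{\gamma_\infty}V(r)>0$$ (with $V(r)^0=1$). Set $$q_*=p\,\frac{\alpha_\infty-\gamma_\infty\beta_\infty+N}{N-\gamma_\infty},\qquad q_{**}=p\,\frac{p\alpha_\infty+(1-p\beta_\infty)\gamma_\infty+p(N-1)}{p(N-1)-\gamma_\infty(p-1)}.$$ Then $\lim_{R\to+\infty}\mathcal R_\infty(q_2,R)=0$ for every real $q_2>\max\{1,p\beta_\infty,q_*,q_{**}\}$. Moreover, with $q^*=p\,\frac{\alpha_\infty-p\beta_\infty+N}{N-p}$ and $\alpha^*=\max\{p\beta_\infty-1-\frac{p-1}{p}N,\,-(1-\beta_\infty)N\}$, if $\gamma_\infty<p$, then the threshold improves on $\max\{1,p\beta_\infty,q^*\}$ in the following sense: $\max\{1,p\beta_\infty,q_*,q_{**}\}=\max\{1,p\beta_\infty,q^*\}$ if $\alpha_\infty\le\alpha^*$, and $\max\{1,p\beta_\infty,q_*,q_{**}\}<\max\{1,p\beta_\infty,q^*\}$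 if $\alpha_\infty>\alpha^*$. -/

import Mathlib

open MeasureTheory Filter Topology
open scoped ENNReal

/-- `g` is a weak gradient on `ℝ^N` of the locally integrable function `u`:
`∫ u ∂_v φ = - ∫ (g · v) φ` for all directions `v` and all test functions `φ ∈ C_c^∞(ℝ^N)`. -/
structure HasWeakGradient {N : ℕ} (u : EuclideanSpace ℝ (Fin N) → ℝ)
    (g : EuclideanSpace ℝ (Fin N) → EuclideanSpace ℝ (Fin N)) : Prop where
  locallyIntegrable : LocallyIntegrable u volume
  locallyIntegrable_grad : LocallyIntegrable g volume
  integral_eq : ∀ φ : EuclideanSpace ℝ (Fin N) → ℝ, ContDiff ℝ (⊤ : ℕ∞) φ → HasCompactSupport φ →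
    ∀ v : EuclideanSpace ℝ (Fin N),
      ∫ x, u x * fderiv ℝ φ x v = - ∫ x, inner ℝ (g x) v * φ x

open Classical in
/-- The weak gradient `∇u` (unique up to null sets when it exists; `0` if there is none). -/
noncomputable def weakGradient {N : ℕ} (u : EuclideanSpace ℝ (Fin N) → ℝ) :
    EuclideanSpace ℝ (Fin N) → EuclideanSpace ℝ (Fin N) :=
  if h : ∃ g, HasWeakGradient u g then h.choose else 0

/-- `u ∈ D^{1,p}(ℝ^N)`: `u ∈ L^{p*}` with `p* = pN/(N-p)`, and `u` has a weak gradient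
`∇u ∈ L^p`. -/
structure MemD1p {N : ℕ} (p : ℝ) (u : EuclideanSpace ℝ (Fin N) → ℝ) : Prop where
  memLp : MemLp u (ENNReal.ofReal (p * N / (N - p))) volume
  exists_grad : ∃ g, HasWeakGradient u g
  memLp_grad : MemLp (weakGradient u) (ENNReal.ofReal p) volume

/-- `u` is (almost everywhere equal to) a radial function. -/
def IsRadialAE {N : ℕ} (u : EuclideanSpace ℝ (Fin N) → ℝ) : Prop :=
  ∃ f : ℝ → ℝ, u =ᵐ[volume] fun x => f ‖x‖

/-- `u ∈ W = D^{1,p}(ℝ^N) ∩ L^p(ℝ^N, V(|x|)dx)`. -/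
def MemW {N : ℕ} (p : ℝ) (V : ℝ → ℝ≥0∞) (u : EuclideanSpace ℝ (Fin N) → ℝ) : Prop :=
  MemD1p p u ∧ ∫⁻ x, V ‖x‖ * ‖u x‖ₑ ^ p < ⊤

/-- `u ∈ W_r`, the radial subspace of `W`. -/
def MemWr {N : ℕ} (p : ℝ) (V : ℝ → ℝ≥0∞) (u : EuclideanSpace ℝ (Fin N) → ℝ) : Prop :=
  MemW p V u ∧ IsRadialAE u

/-- The norm of `W`: `‖u‖^p = ∫ (|∇u|^p + V(|x|)|u|^p) dx`. -/
noncomputable def normW {N : ℕ} (p : ℝ) (V : ℝ → ℝ≥0∞)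
    (u : EuclideanSpace ℝ (Fin N) → ℝ) : ℝ≥0∞ :=
  (∫⁻ x, (‖weakGradient u x‖ₑ ^ p + V ‖x‖ * ‖u x‖ₑ ^ p)) ^ (1 / p)

/-- `R_∞(q,R)`, the supremum over `u ∈ W_r`, `h ∈ W` with `‖u‖ = ‖h‖ = 1` of
`∫_{ℝ^N ∖ B_R} K(|x|) |u|^{q-1} |h| dx`, as an element of `[0,∞]`. -/
noncomputable def RInfty (N : ℕ) (p : ℝ) (V : ℝ → ℝ≥0∞) (K : ℝ → ℝ) (q R : ℝ) : ℝ≥0∞ :=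
  ⨆ (u : EuclideanSpace ℝ (Fin N) → ℝ) (h : EuclideanSpace ℝ (Fin N) → ℝ)
    (_ : MemWr p V u) (_ : MemW p V h) (_ : normW p V u = 1) (_ : normW p V h = 1),
    ∫⁻ x in (Metric.ball (0 : EuclideanSpace ℝ (Fin N)) R)ᶜ,
      ENNReal.ofReal (K ‖x‖) * ‖u x‖ₑ ^ (q - 1) * ‖h x‖ₑ

/-- Assumption (V) on `V : (0,∞) → [0,∞]` (values of `V` outside `(0,∞)` are irrelevant). -/
structure ConditionV (V : ℝ → ℝ≥0∞) : Prop where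
  measurable : Measurable ((Set.Ioi (0 : ℝ)).domRestrict V)
  integrable : ∃ r₁ r₂ : ℝ, 0 < r₁ ∧ r₁ < r₂ ∧ ∫⁻ r in Set.Ioo r₁ r₂, V r < ⊤

/-- Assumption (K) on `K : (0,∞) → (0,∞)` (values of `K` outside `(0,∞)` are irrelevant). -/
structure ConditionK (K : ℝ → ℝ) : Prop where
  pos : ∀ r, 0 < r → 0 < K r
  measurable : Measurable ((Set.Ioi (0 : ℝ)).domRestrict K)
  locally_Ls : ∃ s : ℝ, 1 < s ∧ LocallyIntegrableOn (fun r => K r ^ s) (Set.Ioi (0 : ℝ)) volume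

/-- `q_*(α,β,γ)`. -/
noncomputable def qLowerStar (N p α β γ : ℝ) : ℝ :=
  p * ((α - γ * β + N) / (N - γ))

/-- `q_{**}(α,β,γ)`. -/
noncomputable def qLowerStarStar (N p α β γ : ℝ) : ℝ :=
  p * ((p * α + (1 - p * β) * γ + p * (N - 1)) / (p * (N - 1) - γ * (p - 1)))

/-- `q^*(α,β)`, the exponent obtained without a separate growth assumption on `V`. -/
noncomputable def qUpperStar (N p α β : ℝ) : ℝ :=
  p * ((α - p * β + N) / (N - p))

/-- `α^*(β)`. -/
noncomputable def alphaUpperStar (N p β : ℝ) : ℝ :=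
  max (p * β - 1 - (p - 1) / p * N) (-(1 - β) * N)

/-! Beyond `R₂` the bound `V ≥ b r^(-γ)` lets the power of `V` be raised at the cost of a power of
`r`: `K ≤ C r^(α+γ(δ-β)) V^δ` for every `δ ≥ β` (`ofReal_rpow_mul_rpow_le`). Hölder against `∫
V|u|^p ≤ 1` and `∫ V|h|^p ≤ 1` then finishes, in two ranges. If `q < p`, the choice `δ = q/p` leaves
a power of `|x|` to be integrated with Hölder exponent `(p-q)/p`; it is integrable at infinity
exactly when `q > q_*`. If `q ≥ p`, the choice `δ = 1` leaves a surplus `|u|^(q-p)`, absorbed by the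
decay `|u| ≤ C |x|^(-ν)`, `ν = (p(N-1) - γ(p-1))/p²` (`exists_radial_decay`); the total power of
`|x|` is negative exactly when `q > q_**`.

For a smooth profile the decay comes from bounding `|f(r)|^p` by `p ∫_r^∞ |f|^(p-1)|f'|`, then
Hölder. To avoid choosing an absolutely continuous representative, the weak gradient is tested on
radial fields: this bounds `|f(s) - f(t)|`, for almost all radii, by the integral of `|∇u||x|^(1-N)`
over the annulus between them. Stopping at the infimum of the radii where `|f|` has halved gives the
inequality up to a constant (`HasWeakGradient.ae_rpow_le_of_radial`).

The comparison with `q^*` is algebra: both lower thresholds equal `q^*` at `γ = p`, so the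
cross-multiplied differences carry the factor `p - γ`. -/

/-! ### Comparison of the threshold exponents -/

theorem qLowerStar_lt_qUpperStar {N p α β γ : ℝ} (hp : 1 < p) (hpN : p < N) (hγ : γ < p)
    (hα : -(1 - β) * N < α) : qLowerStar N p α β γ < qUpperStar N p α β := by
  unfold qLowerStar qUpperStar
  refine mul_lt_mul_of_pos_left ?_ (by linarith)
  rw [div_lt_div_iff₀ (by linarith) (by linarith)]
  -- The cross-multiplied difference is exactly `(p - γ)(α + (1 - β)N)`.
  nlinarith [mul_pos (sub_pos.2 hγ) (sub_pos.2 hα)]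

theorem qLowerStar_le_mul {N p α β γ : ℝ} (hp : 1 < p) (hpN : p < N) (hγ : γ < p)
    (hα : α ≤ -(1 - β) * N) : qLowerStar N p α β γ ≤ p * β := by
  unfold qLowerStar
  refine mul_le_mul_of_nonneg_left ?_ (by linarith)
  rw [div_le_iff₀ (by linarith)]
  linarith

theorem qLowerStarStar_lt_qUpperStar {N p α β γ : ℝ} (hp : 1 < p) (hpN : p < N) (hγ : γ < p)
    (hα : -(p * (N - 1) * (1 - β)) < α * (p - 1)) :
    qLowerStarStar N p α β γ < qUpperStar N p α β := by
  unfold qLowerStarStar qUpperStar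
  refine mul_lt_mul_of_pos_left ?_ (by linarith)
  rw [div_lt_div_iff₀ (by nlinarith) (by linarith)]
  -- Here the difference is exactly `(p - γ)((p - 1)α + p(N - 1)(1 - β))`.
  nlinarith [mul_pos (sub_pos.2 hγ) (sub_pos.2 hα)]

theorem qLowerStarStar_le_mul {N p α β γ : ℝ} (hp : 1 < p) (hpN : p < N) (hγ : γ < p)
    (hβ : β ≤ 1) (hα : α * (p - 1) ≤ -(p * (N - 1) * (1 - β))) :
    qLowerStarStar N p α β γ ≤ p * β := by
  have hD : 0 < p * (N - 1) - γ * (p - 1) := by nlinarith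
  unfold qLowerStarStar
  refine mul_le_mul_of_nonneg_left ?_ (by linarith)
  rw [div_le_iff₀ hD]
  have h1 : 0 < p - 1 := by linarith
  refine le_of_mul_le_mul_right ?_ h1
  have h2 : 0 ≤ (1 - β) * (p * (N - 1) - γ * (p - 1)) :=
    mul_nonneg (by linarith) hD.le
  -- At the extreme value of `α`, the slack after multiplying by `p - 1` is exactly the quantity in
  -- `h2`.
  nlinarith [mul_le_mul_of_nonneg_left hα (by linarith : (0 : ℝ) ≤ p)]

/-- The two entries of `α^*` are the values of `α` at which `q^*` equals `1` and `pβ` respectively.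
-/
theorem qUpperStar_le_max_iff {N p α β : ℝ} (hp : 1 < p) (hpN : p < N) :
    qUpperStar N p α β ≤ max 1 (p * β) ↔ α ≤ alphaUpperStar N p β := by
  unfold qUpperStar alphaUpperStar
  have hp0 : 0 < p := by linarith
  rw [le_max_iff, le_max_iff]
  refine or_congr ?_ ?_
  · rw [← mul_div_assoc, div_le_iff₀ (by linarith), ← sub_nonneg, ← sub_nonneg (b := α)]
    have : 1 * (N - p) - p * (α - p * β + N) = p * (p * β - 1 - (p - 1) / p * N - α) := by
      field_simp
      ring
    rw [this, mul_nonneg_iff_of_pos_left hp0]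
  · rw [mul_le_mul_iff_right₀ hp0, div_le_iff₀ (by linarith)]
    constructor <;> intro h <;> linarith

theorem max_qLowerStar_eq {N p α β γ : ℝ} (hp : 1 < p) (hpN : p < N) (hγ : γ < p)
    (hβ : β ≤ 1) (hα : α ≤ alphaUpperStar N p β) :
    max (max 1 (p * β)) (max (qLowerStar N p α β γ) (qLowerStarStar N p α β γ)) =
      max (max 1 (p * β)) (qUpperStar N p α β) := by
  have h := (qUpperStar_le_max_iff (β := β) hp hpN).2 hα
  have hm : p * β ≤ max 1 (p * β) := le_max_right _ _
  rw [max_eq_left h, max_eq_left]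
  -- Each lower threshold is either at most `pβ` or below `q^*`, according to the sign of its own
  -- difference factor.
  refine max_le ?_ ?_
  · rcases le_or_gt α (-(1 - β) * N) with h1 | h1
    · exact (qLowerStar_le_mul hp hpN hγ h1).trans hm
    · exact (qLowerStar_lt_qUpperStar hp hpN hγ h1).le.trans h
  · rcases le_or_gt (α * (p - 1)) (-(p * (N - 1) * (1 - β))) with h1 | h1
    · exact (qLowerStarStar_le_mul hp hpN hγ hβ h1).trans hm
    · exact (qLowerStarStar_lt_qUpperStar hp hpN hγ h1).le.trans h

theorem max_qLowerStar_lt {N p α β γ : ℝ} (hp : 1 < p) (hpN : p < N) (hγ : γ < p)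
    (hβ : β ≤ 1) (hα : alphaUpperStar N p β < α) :
    max (max 1 (p * β)) (max (qLowerStar N p α β γ) (qLowerStarStar N p α β γ)) <
      max (max 1 (p * β)) (qUpperStar N p α β) := by
  have h : max 1 (p * β) < qUpperStar N p α β := by
    rw [← not_le, qUpperStar_le_max_iff hp hpN, not_le]
    exact hα
  have h1 : -(1 - β) * N < α := (le_max_right _ _).trans_lt hα
  rw [max_eq_right h.le]
  refine max_lt h (max_lt (qLowerStar_lt_qUpperStar hp hpN hγ h1)
    (qLowerStarStar_lt_qUpperStar hp hpN hγ ?_))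
  have h2 : -(1 - β) * N * (p - 1) < α * (p - 1) := mul_lt_mul_of_pos_right h1 (by linarith)
  -- The condition for `q_**` follows from that for `q_*`, since `p(N - 1) - N(p - 1) = N - p`.
  nlinarith [mul_nonneg (sub_nonneg.2 hβ) (sub_nonneg.2 hpN.le)]

/-! ### Radial test fields and the divergence identity -/

theorem contDiff_of_eventually_eq_zero {w : ℝ → ℝ} (hw : ∀ r ≠ 0, ContDiffAt ℝ (⊤ : ℕ∞) w r)
    (h0 : ∀ᶠ r in 𝓝 (0 : ℝ), w r = 0) : ContDiff ℝ (⊤ : ℕ∞) w := by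
  rw [contDiff_iff_contDiffAt]
  intro r
  rcases eq_or_ne r 0 with rfl | hr
  · exact (contDiffAt_const (c := (0 : ℝ))).congr_of_eventuallyEq h0
  · exact hw r hr

theorem eventually_comp_norm_eq_zero {N : ℕ} {w : ℝ → ℝ} (h0 : ∀ᶠ r in 𝓝 (0 : ℝ), w r = 0) :
    ∀ᶠ x in 𝓝 (0 : EuclideanSpace ℝ (Fin N)), w ‖x‖ = 0 :=
  (by simpa using (continuous_norm (E := EuclideanSpace ℝ (Fin N))).tendsto 0 :
    Tendsto (fun x : EuclideanSpace ℝ (Fin N) => ‖x‖) (𝓝 0) (𝓝 0)).eventually h0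

theorem contDiff_comp_norm {N : ℕ} {w : ℝ → ℝ} (hw : ContDiff ℝ (⊤ : ℕ∞) w)
    (h0 : ∀ᶠ r in 𝓝 (0 : ℝ), w r = 0) :
    ContDiff ℝ (⊤ : ℕ∞) fun x : EuclideanSpace ℝ (Fin N) => w ‖x‖ := by
  rw [contDiff_iff_contDiffAt]
  intro x
  rcases eq_or_ne x 0 with rfl | hx
  · exact (contDiffAt_const (c := (0 : ℝ))).congr_of_eventuallyEq (eventually_comp_norm_eq_zero h0)
  · exact hw.contDiffAt.comp x (contDiffAt_norm ℝ hx)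

theorem hasCompactSupport_comp_norm {N : ℕ} {w : ℝ → ℝ} (hc : HasCompactSupport w) :
    HasCompactSupport fun x : EuclideanSpace ℝ (Fin N) => w ‖x‖ :=
  by
  obtain ⟨R, hR⟩ := hc.isBounded.subset_closedBall (0 : ℝ)
  refine HasCompactSupport.intro (isCompact_closedBall (0 : EuclideanSpace ℝ (Fin N)) R) ?_
  intro x hx
  by_contra hne
  have := hR (subset_tsupport _ hne)
  simp at this hx
  linarith

theorem fderiv_coord_mul_comp_norm {N : ℕ} {w : ℝ → ℝ} (hw : ContDiff ℝ (⊤ : ℕ∞) w)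
    (h0 : ∀ᶠ r in 𝓝 (0 : ℝ), w r = 0) (i : Fin N) (x : EuclideanSpace ℝ (Fin N)) :
    fderiv ℝ (fun y : EuclideanSpace ℝ (Fin N) => y i * w ‖y‖) x (EuclideanSpace.single i 1) =
      w ‖x‖ + x i ^ 2 * (‖x‖⁻¹ * deriv w ‖x‖) := by
  rcases eq_or_ne x 0 with rfl | hx
  · have h1 : (fun y : EuclideanSpace ℝ (Fin N) => y i * w ‖y‖) =ᶠ[𝓝 0] fun _ => 0 := by
      filter_upwards [eventually_comp_norm_eq_zero h0] with y hy
      simp [hy]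
    rw [h1.fderiv_eq]
    simp [h0.self_of_nhds]
  · have h1 : HasFDerivAt (fun y : EuclideanSpace ℝ (Fin N) => y i)
        (EuclideanSpace.proj i : EuclideanSpace ℝ (Fin N) →L[ℝ] ℝ) x :=
      (EuclideanSpace.proj i : EuclideanSpace ℝ (Fin N) →L[ℝ] ℝ).hasFDerivAt
    have h2 : HasFDerivAt (fun y : EuclideanSpace ℝ (Fin N) => ‖y‖)
        (‖x‖⁻¹ • innerSL ℝ x) x := by
      have h3 := (HasStrictFDerivAt.hasFDerivAt (hasStrictFDerivAt_norm_sq x)).sqrt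
        (by positivity)
      simp only [Real.sqrt_sq (norm_nonneg _)] at h3
      have hn : ‖x‖ ≠ 0 := norm_ne_zero_iff.2 hx
      have h4 : (1 / (2 * ‖x‖)) • 2 • innerSL ℝ x = ‖x‖⁻¹ • innerSL ℝ x := by
        rw [← Nat.cast_smul_eq_nsmul ℝ, smul_smul]
        congr 1
        push_cast
        field_simp
      rwa [h4] at h3
    have h4 : HasDerivAt w (deriv w ‖x‖) ‖x‖ :=
      (hw.differentiable (by simp) _).hasDerivAt
    have h5 := h1.mul (h4.comp_hasFDerivAt x h2)
    have h6 := h5.fderiv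
    simp only [Function.comp_def] at h6
    erw [h6]
    simp [EuclideanSpace.inner_single_right]
    ring

/-- This is the weak formulation tested on the field `w(|x|) x`, whose divergence is `N w + r w'`,
one coordinate at a time. Vanishing of `w` near `0` makes the field smooth at the origin. -/
theorem HasWeakGradient.integral_mul_radial_div {N : ℕ} {u : EuclideanSpace ℝ (Fin N) → ℝ}
    {g : EuclideanSpace ℝ (Fin N) → EuclideanSpace ℝ (Fin N)} (h : HasWeakGradient u g)
    {w : ℝ → ℝ} (hw : ContDiff ℝ (⊤ : ℕ∞) w) (hc : HasCompactSupport w)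
    (h0 : ∀ᶠ r in 𝓝 (0 : ℝ), w r = 0) :
    ∫ x, u x * (N * w ‖x‖ + ‖x‖ * deriv w ‖x‖) = - ∫ x, inner ℝ (g x) x * w ‖x‖ := by
  set φ : Fin N → EuclideanSpace ℝ (Fin N) → ℝ := fun i y => y i * w ‖y‖ with hφ
  have hφd : ∀ i, ContDiff ℝ (⊤ : ℕ∞) (φ i) := fun i =>
    (EuclideanSpace.proj i : EuclideanSpace ℝ (Fin N) →L[ℝ] ℝ).contDiff.mul
      (contDiff_comp_norm hw h0)
  have hφc : ∀ i, HasCompactSupport (φ i) := fun i => (hasCompactSupport_comp_norm hc).mul_left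
  have key := fun i => h.integral_eq (φ i) (hφd i) (hφc i) (EuclideanSpace.single i 1)
  have hsum := Finset.sum_congr (rfl : (Finset.univ : Finset (Fin N)) = Finset.univ)
    fun i _ => key i
  rw [← integral_finsetSum, Finset.sum_neg_distrib, ← integral_finsetSum] at hsum
  · have h1 : ∀ x, u x * (N * w ‖x‖ + ‖x‖ * deriv w ‖x‖) =
        ∑ i, u x * fderiv ℝ (φ i) x (EuclideanSpace.single i 1) := by
      intro x
      rw [← Finset.mul_sum]
      congr 1
      simp only [hφ, fderiv_coord_mul_comp_norm hw h0]
      rw [Finset.sum_add_distrib, ← Finset.sum_mul, ← EuclideanSpace.real_norm_sq_eq]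
      rcases eq_or_ne x 0 with rfl | hx
      · simp
      · have : ‖x‖ ≠ 0 := norm_ne_zero_iff.2 hx
        simp
        field_simp
    have h2 : ∀ x, inner ℝ (g x) x * w ‖x‖ =
        ∑ i, inner ℝ (g x) (EuclideanSpace.single i 1) * φ i x := by
      intro x
      rw [PiLp.inner_apply, Finset.sum_mul]
      refine Finset.sum_congr rfl fun i _ => ?_
      simp [hφ, EuclideanSpace.inner_single_right]
      ring
    simp only [h1, h2]
    exact hsum
  · intro i _
    have h1 : Integrable (fun x => φ i x • g x) volume :=
      h.locallyIntegrable_grad.integrable_smul_left_of_hasCompactSupport (hφd i).continuous (hφc i)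
    refine (h1.inner_const (𝕜 := ℝ) (EuclideanSpace.single i 1)).congr (.of_forall fun x => ?_)
    simp only [real_inner_smul_left]
    ring
  · intro i _
    refine h.locallyIntegrable.integrable_smul_right_of_hasCompactSupport (g := fun x =>
      fderiv ℝ (φ i) x (EuclideanSpace.single i 1)) ?_ ?_
    · exact ((hφd i).continuous_fderiv (by simp)).clm_apply continuous_const
    · exact (hφc i).fderiv_apply ℝ _

/-! ### Polar coordinates, radial flux and the one-dimensional profile -/

theorem ae_norm_of_ae {N : ℕ} [NeZero N] {P : ℝ → Prop} (h : ∀ᵐ r : ℝ, P r) :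
    ∀ᵐ x : EuclideanSpace ℝ (Fin N), P ‖x‖ := by
  obtain ⟨T, hT, hTm, hT0⟩ := exists_measurable_superset_of_null (ae_iff.1 h)
  set F : ℝ → ℝ := T.indicator 1 with hF
  have h0 : F =ᵐ[volume] 0 := indicator_meas_zero hT0
  have h1 : (fun y : ℝ => y ^ (Module.finrank ℝ (EuclideanSpace ℝ (Fin N)) - 1) • F y)
      =ᵐ[volume.restrict (Set.Ioi 0)] 0 := by
    filter_upwards [ae_restrict_of_ae h0] with y hy
    simp [hy]
  have hint : Integrable (fun x : EuclideanSpace ℝ (Fin N) => F ‖x‖) volume := by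
    rw [integrable_fun_norm_addHaar]
    exact (integrable_zero _ _ _).congr h1.symm
  have hz : ∫ x : EuclideanSpace ℝ (Fin N), F ‖x‖ = 0 := by
    rw [integral_fun_norm_addHaar, integral_congr_ae h1]
    simp
  have hnn : 0 ≤ fun x : EuclideanSpace ℝ (Fin N) => F ‖x‖ :=
    fun x => Set.indicator_nonneg (fun _ _ => zero_le_one) _
  filter_upwards [(integral_eq_zero_iff_of_nonneg hnn hint).1 hz] with x hx
  by_contra hc
  have : ‖x‖ ∈ T := hT hc
  simp [hF, this] at hx

/-- The measure on `ℝ^N` with density `|g(x)| |x|^{1-N}`. -/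
noncomputable def radialFlux {N : ℕ} (g : EuclideanSpace ℝ (Fin N) → EuclideanSpace ℝ (Fin N)) :
    Measure (EuclideanSpace ℝ (Fin N)) :=
  volume.withDensity fun x => ‖g x‖ₑ * ENNReal.ofReal (‖x‖ * (‖x‖ ^ N)⁻¹)

theorem measurableSet_norm_preimage {N : ℕ} {s : Set ℝ} (hs : MeasurableSet s) :
    MeasurableSet ((fun x : EuclideanSpace ℝ (Fin N) => ‖x‖) ⁻¹' s) :=
  measurable_norm hs

theorem radialFlux_Icc_lt_top {N : ℕ}
    {g : EuclideanSpace ℝ (Fin N) → EuclideanSpace ℝ (Fin N)} (hg : LocallyIntegrable g volume)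
    {c d : ℝ} (hc : 0 < c) :
    radialFlux g ((fun x => ‖x‖) ⁻¹' Set.Icc c d) < ⊤ := by
  have hm := measurableSet_norm_preimage (N := N) (measurableSet_Icc (a := c) (b := d))
  rw [radialFlux, withDensity_apply _ hm]
  have hi : IntegrableOn g ((fun x => ‖x‖) ⁻¹' Set.Icc c d) volume :=
    (hg.integrableOn_isCompact (isCompact_closedBall 0 d)).mono_set fun x hx => by simpa using hx.2
  calc ∫⁻ x in (fun x => ‖x‖) ⁻¹' Set.Icc c d, ‖g x‖ₑ * ENNReal.ofReal (‖x‖ * (‖x‖ ^ N)⁻¹)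
      ≤ ∫⁻ x in (fun x => ‖x‖) ⁻¹' Set.Icc c d, ‖g x‖ₑ * ENNReal.ofReal (d * (c ^ N)⁻¹) := by
        refine setLIntegral_mono' hm fun x hx => ?_
        have := hx.1
        have := hx.2
        gcongr
        exact hc.le.trans (by linarith)
    _ = (∫⁻ x in (fun x => ‖x‖) ⁻¹' Set.Icc c d, ‖g x‖ₑ) * ENNReal.ofReal (d * (c ^ N)⁻¹) :=
        lintegral_mul_const' _ _ ENNReal.ofReal_ne_top
    _ < ⊤ := ENNReal.mul_lt_top hi.2 ENNReal.ofReal_lt_top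

/-- A weak one-dimensional derivative bound for the profile. With `w = H r^(-N)` the divergence
becomes `r^(1-N) H'`, and its weight cancels the Jacobian `r^(N-1)`; the prefactor is the area of
the unit sphere. -/
theorem HasWeakGradient.enorm_integral_profile_le {N : ℕ} [NeZero N]
    {u : EuclideanSpace ℝ (Fin N) → ℝ}
    {g : EuclideanSpace ℝ (Fin N) → EuclideanSpace ℝ (Fin N)} (h : HasWeakGradient u g)
    {f : ℝ → ℝ} (hf : u =ᵐ[volume] fun x => f ‖x‖)
    {H : ℝ → ℝ} (hH : ContDiff ℝ (⊤ : ℕ∞) H) (hc : HasCompactSupport H)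
    (h0 : ∀ᶠ r in 𝓝 (0 : ℝ), H r = 0) :
    N * volume (Metric.ball (0 : EuclideanSpace ℝ (Fin N)) 1) *
      ‖∫ r in Set.Ioi (0 : ℝ), f r * deriv H r‖ₑ ≤
      ∫⁻ x, ‖H ‖x‖‖ₑ * (‖g x‖ₑ * ENNReal.ofReal (‖x‖ * (‖x‖ ^ N)⁻¹)) := by
  set w : ℝ → ℝ := fun r => H r * (r ^ N)⁻¹ with hw
  have hw0 : ∀ᶠ r in 𝓝 (0 : ℝ), w r = 0 := by
    filter_upwards [h0] with r hr
    simp [hw, hr]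
  have hwd : ContDiff ℝ (⊤ : ℕ∞) w := by
    refine contDiff_of_eventually_eq_zero (fun r hr => ?_) hw0
    exact hH.contDiffAt.mul ((contDiffAt_id.pow N).inv (pow_ne_zero _ hr))
  have hwc : HasCompactSupport w := hc.mul_right
  have key := h.integral_mul_radial_div hwd hwc hw0
  have hder : ∀ r : ℝ, N * w r + r * deriv w r = r * (r ^ N)⁻¹ * deriv H r := by
    intro r
    rcases eq_or_ne r 0 with rfl | hr
    · simp [hw0.self_of_nhds]
    · have h1 : HasDerivAt w (deriv H r * (r ^ N)⁻¹ +
          H r * (-(N * r ^ (N - 1)) / (r ^ N) ^ 2)) r :=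
        (hH.differentiable (by simp) r).hasDerivAt.mul
          ((hasDerivAt_pow N r).inv (pow_ne_zero _ hr))
      obtain ⟨n, rfl⟩ := Nat.exists_eq_succ_of_ne_zero (NeZero.ne N)
      rw [h1.deriv]
      simp only [hw]
      simp only [Nat.succ_eq_add_one, Nat.add_sub_cancel]
      field_simp
      ring
  have hl : ∫ x, u x * (N * w ‖x‖ + ‖x‖ * deriv w ‖x‖) =
      N * volume.real (Metric.ball (0 : EuclideanSpace ℝ (Fin N)) 1) *
        ∫ r in Set.Ioi (0 : ℝ), f r * deriv H r := by
    have h1 : ∫ x, u x * (N * w ‖x‖ + ‖x‖ * deriv w ‖x‖) =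
        ∫ x : EuclideanSpace ℝ (Fin N),
          (fun r => f r * (r * (r ^ N)⁻¹ * deriv H r)) ‖x‖ := by
      refine integral_congr_ae ?_
      filter_upwards [hf] with x hx
      simp only [hder]
      rw [hx]
    rw [h1, integral_fun_norm_addHaar volume fun r => f r * (r * (r ^ N)⁻¹ * deriv H r)]
    simp only [finrank_euclideanSpace, Fintype.card_fin, nsmul_eq_mul, smul_eq_mul, mul_assoc]
    congr 2
    refine setIntegral_congr_fun measurableSet_Ioi fun r hr => ?_
    have hr' : r ≠ 0 := ne_of_gt hr
    obtain ⟨n, rfl⟩ := Nat.exists_eq_succ_of_ne_zero (NeZero.ne N)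
    simp only [Nat.succ_eq_add_one, Nat.add_sub_cancel]
    field_simp
    ring
  rw [hl] at key
  have h2 : N * volume (Metric.ball (0 : EuclideanSpace ℝ (Fin N)) 1) *
      ‖∫ r in Set.Ioi (0 : ℝ), f r * deriv H r‖ₑ =
      ‖N * volume.real (Metric.ball (0 : EuclideanSpace ℝ (Fin N)) 1) *
        ∫ r in Set.Ioi (0 : ℝ), f r * deriv H r‖ₑ := by
    rw [enorm_mul, enorm_mul, Real.enorm_of_nonneg (Nat.cast_nonneg N),
      Real.enorm_of_nonneg measureReal_nonneg, ENNReal.ofReal_natCast,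
      ofReal_measureReal measure_ball_lt_top.ne]
  rw [h2, key, enorm_neg]
  refine (enorm_integral_le_lintegral_enorm _).trans (lintegral_mono fun x => ?_)
  rw [enorm_mul, hw]
  simp only [enorm_mul]
  have h3 : ‖inner ℝ (g x) x‖ₑ ≤ ‖g x‖ₑ * ‖x‖ₑ := by
    rw [← ofReal_norm, ← ofReal_norm, ← ofReal_norm, ← ENNReal.ofReal_mul (norm_nonneg _)]
    exact ENNReal.ofReal_le_ofReal (norm_inner_le_norm _ _)
  rw [ENNReal.ofReal_mul (norm_nonneg _), ofReal_norm,
    ← Real.enorm_of_nonneg (by positivity : 0 ≤ (‖x‖ ^ N)⁻¹)]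
  calc _ ≤ (‖g x‖ₑ * ‖x‖ₑ) * (‖H ‖x‖‖ₑ * ‖(‖x‖ ^ N)⁻¹‖ₑ) := by gcongr
    _ = _ := by ring

theorem integrableOn_profile {N : ℕ} [NeZero N]
    {u : EuclideanSpace ℝ (Fin N) → ℝ} (hu : LocallyIntegrable u volume)
    {f : ℝ → ℝ} (hf : u =ᵐ[volume] fun x => f ‖x‖) {a b : ℝ} (ha : 0 < a) :
    IntegrableOn f (Set.Icc a b) volume := by
  have hm := measurableSet_norm_preimage (N := N) (measurableSet_Icc (a := a) (b := b))
  have h1 : IntegrableOn u ((fun x => ‖x‖) ⁻¹' Set.Icc a b) volume :=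
    (hu.integrableOn_isCompact (isCompact_closedBall 0 b)).mono_set fun x hx => by simpa using hx.2
  have h2 : Integrable (fun x : EuclideanSpace ℝ (Fin N) => (Set.Icc a b).indicator f ‖x‖)
      volume := by
    refine ((integrable_indicator_iff hm).2 h1).congr ?_
    filter_upwards [hf] with x hx
    by_cases hx' : ‖x‖ ∈ Set.Icc a b
    · rw [Set.indicator_of_mem (by exact hx'), Set.indicator_of_mem hx', hx]
    · rw [Set.indicator_of_notMem (by exact hx'), Set.indicator_of_notMem hx']
  rw [integrable_fun_norm_addHaar] at h2
  have h3 := h2.mono_set (fun r hr => ha.trans_le hr.1 : Set.Icc a b ⊆ Set.Ioi 0)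
  have h4 : ContinuousOn
      (fun y : ℝ => (y ^ (Module.finrank ℝ (EuclideanSpace ℝ (Fin N)) - 1))⁻¹) (Set.Icc a b) :=
    (continuousOn_id.pow _).inv₀ fun y hy => pow_ne_zero _ (ha.trans_le hy.1).ne'
  refine (h3.continuousOn_mul h4 isCompact_Icc).congr_fun (fun y hy => ?_) measurableSet_Icc
  have hy' : y ≠ 0 := (ha.trans_le hy.1).ne'
  simp only [Set.indicator_of_mem hy, smul_eq_mul]
  field_simp

theorem locallyIntegrable_indicator_profile {N : ℕ} [NeZero N]
    {u : EuclideanSpace ℝ (Fin N) → ℝ} (hu : LocallyIntegrable u volume)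
    {f : ℝ → ℝ} (hf : u =ᵐ[volume] fun x => f ‖x‖) {a : ℝ} (ha : 0 < a) :
    LocallyIntegrable ((Set.Ioi a).indicator f) volume := by
  rw [locallyIntegrable_iff]
  intro k hk
  obtain ⟨R, hR⟩ := hk.isBounded.subset_closedBall (0 : ℝ)
  rw [IntegrableOn, integrable_indicator_iff measurableSet_Ioi, IntegrableOn,
    Measure.restrict_restrict measurableSet_Ioi]
  refine (integrableOn_profile hu hf ha (b := R)).mono_set fun r hr => ⟨hr.1.le, ?_⟩
  have := hR hr.2
  simp only [Metric.mem_closedBall, dist_zero_right, Real.norm_eq_abs] at this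
  exact (le_abs_self r).trans this

/-! ### Oscillation of the profile between Lebesgue points -/

/-- A smooth approximation of the indicator function of `(0, ∞)`. -/
noncomputable def smoothStep (φ : ContDiffBump (0 : ℝ)) (r : ℝ) : ℝ :=
  ∫ y in (-φ.rOut)..r, φ.normed volume y

theorem hasDerivAt_smoothStep (φ : ContDiffBump (0 : ℝ)) (r : ℝ) :
    HasDerivAt (smoothStep φ) (φ.normed volume r) r :=
  φ.continuous_normed.integral_hasStrictDerivAt _ _ |>.hasDerivAt

theorem contDiff_smoothStep (φ : ContDiffBump (0 : ℝ)) : ContDiff ℝ (⊤ : ℕ∞) (smoothStep φ) := by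
  rw [contDiff_infty_iff_deriv]
  refine ⟨fun r => (hasDerivAt_smoothStep φ r).differentiableAt, ?_⟩
  rw [funext fun r => (hasDerivAt_smoothStep φ r).deriv]
  exact φ.contDiff_normed

theorem ContDiffBump.normed_eq_zero_of_le_abs (φ : ContDiffBump (0 : ℝ)) {r : ℝ}
    (hr : φ.rOut ≤ |r|) : φ.normed volume r = 0 := by
  by_contra h
  have : r ∈ Function.support (φ.normed volume) := h
  rw [φ.support_normed_eq] at this
  simp at this
  linarith

theorem smoothStep_mono (φ : ContDiffBump (0 : ℝ)) : Monotone (smoothStep φ) :=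
  monotone_of_hasDerivAt_nonneg (hasDerivAt_smoothStep φ) fun r => φ.nonneg_normed r

theorem smoothStep_of_le (φ : ContDiffBump (0 : ℝ)) {r : ℝ} (hr : r ≤ -φ.rOut) :
    smoothStep φ r = 0 := by
  rw [smoothStep, intervalIntegral.integral_congr (g := fun _ => 0), intervalIntegral.integral_zero]
  intro y hy
  rw [Set.uIcc_of_ge hr] at hy
  refine φ.normed_eq_zero_of_le_abs ?_
  rw [abs_of_nonpos (by linarith [hy.2, φ.rOut_pos])]
  linarith [hy.2]

theorem smoothStep_of_ge (φ : ContDiffBump (0 : ℝ)) {r : ℝ} (hr : φ.rOut ≤ r) :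
    smoothStep φ r = 1 := by
  have := φ.rOut_pos
  rw [smoothStep, intervalIntegral.integral_of_le (by linarith),
    setIntegral_eq_integral_of_forall_compl_eq_zero, φ.integral_normed]
  intro y hy
  refine φ.normed_eq_zero_of_le_abs ?_
  rw [le_abs]
  by_contra h
  push Not at h
  exact hy ⟨by linarith, by linarith⟩

theorem smoothStep_nonneg (φ : ContDiffBump (0 : ℝ)) (r : ℝ) : 0 ≤ smoothStep φ r := by
  rcases le_total r (-φ.rOut) with h | h
  · exact (smoothStep_of_le φ h).ge
  · exact (smoothStep_of_le φ le_rfl).ge.trans (smoothStep_mono φ h)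

theorem smoothStep_le_one (φ : ContDiffBump (0 : ℝ)) (r : ℝ) : smoothStep φ r ≤ 1 := by
  rcases le_total φ.rOut r with h | h
  · exact (smoothStep_of_ge φ h).le
  · exact (smoothStep_mono φ h).trans (smoothStep_of_ge φ le_rfl).le

open scoped Convolution in
-- The test profile `H` is a smoothed indicator of `[s, t]`. Its derivative is a bump at `s` minus a
-- bump at `t`, so pairing it with `f` yields the difference of two mollified values, while `|H| ≤
-- 1` bounds the other side by the flux.
theorem HasWeakGradient.enorm_convolution_sub_le {N : ℕ} [NeZero N]
    {u : EuclideanSpace ℝ (Fin N) → ℝ}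
    {g : EuclideanSpace ℝ (Fin N) → EuclideanSpace ℝ (Fin N)} (h : HasWeakGradient u g)
    {f : ℝ → ℝ} (hf : u =ᵐ[volume] fun x => f ‖x‖) {a s t ε : ℝ} (ha : 0 < a) (hst : s < t)
    (φ : ContDiffBump (0 : ℝ)) (hε : φ.rOut ≤ ε) (hφ : φ.rOut ≤ s - a) :
    N * volume (Metric.ball (0 : EuclideanSpace ℝ (Fin N)) 1) *
      ‖(φ.normed volume ⋆[ContinuousLinearMap.lsmul ℝ ℝ, volume] (Set.Ioi a).indicator f) s -
        (φ.normed volume ⋆[ContinuousLinearMap.lsmul ℝ ℝ, volume] (Set.Ioi a).indicator f) t‖ₑ ≤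
      radialFlux g ((fun x => ‖x‖) ⁻¹' Set.Icc (s - ε) (t + ε)) := by
  set f₁ := (Set.Ioi a).indicator f with hf₁
  have hφ0 := φ.rOut_pos
  set H : ℝ → ℝ := fun r => smoothStep φ (r - s) - smoothStep φ (r - t) with hH
  have hH0 : ∀ r, r ∉ Set.Icc (s - φ.rOut) (t + φ.rOut) → H r = 0 := by
    intro r hr
    simp only [Set.mem_Icc, not_and_or, not_le] at hr
    rcases hr with hr | hr
    · simp only [hH]
      rw [smoothStep_of_le φ (by linarith), smoothStep_of_le φ (by linarith), sub_zero]
    · simp only [hH]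
      rw [smoothStep_of_ge φ (by linarith), smoothStep_of_ge φ (by linarith), sub_self]
  have hHd : ContDiff ℝ (⊤ : ℕ∞) H :=
    ((contDiff_smoothStep φ).comp (contDiff_id.sub contDiff_const)).sub
      ((contDiff_smoothStep φ).comp (contDiff_id.sub contDiff_const))
  have hHc : HasCompactSupport H := HasCompactSupport.intro isCompact_Icc hH0
  have hH00 : ∀ᶠ r in 𝓝 (0 : ℝ), H r = 0 := by
    filter_upwards [Iio_mem_nhds ha] with r hr
    refine hH0 r fun hr' => ?_
    have := hr'.1
    simp only [Set.mem_Iio] at hr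
    linarith
  have hder : ∀ r, deriv H r = φ.normed volume (r - s) - φ.normed volume (r - t) := fun r =>
    (((hasDerivAt_smoothStep φ (r - s)).comp_sub_const r s).sub
      ((hasDerivAt_smoothStep φ (r - t)).comp_sub_const r t)).deriv
  have hHle : ∀ r, ‖H r‖ₑ ≤ 1 := by
    intro r
    have h1 : |H r| ≤ 1 := by
      rw [abs_le]
      constructor <;> simp only [hH] <;>
      linarith [smoothStep_nonneg φ (r - s), smoothStep_nonneg φ (r - t),
        smoothStep_le_one φ (r - s), smoothStep_le_one φ (r - t)]
    rw [← ofReal_norm, Real.norm_eq_abs]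
    exact ENNReal.ofReal_le_one.2 h1
  have hconv : ∀ c, (φ.normed volume ⋆[ContinuousLinearMap.lsmul ℝ ℝ, volume] f₁) c =
      ∫ r, f₁ r * φ.normed volume (r - c) := by
    intro c
    rw [convolution_eq_swap]
    refine integral_congr_ae (.of_forall fun r => ?_)
    simp only [ContinuousLinearMap.lsmul_apply, smul_eq_mul]
    rw [← neg_sub, φ.normed_neg, mul_comm]
  have hint : ∀ c, Integrable (fun r => f₁ r * φ.normed volume (r - c)) volume := by
    intro c
    refine (locallyIntegrable_indicator_profile h.locallyIntegrable hf
      ha).integrable_smul_right_of_hasCompactSupport (g := fun r => φ.normed volume (r - c)) ?_ ?_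
    · exact φ.continuous_normed.comp (continuous_id.sub continuous_const)
    · exact φ.hasCompactSupport_normed.comp_homeomorph (Homeomorph.subRight c)
  have hI : ∫ r in Set.Ioi (0 : ℝ), f r * deriv H r =
      (φ.normed volume ⋆[ContinuousLinearMap.lsmul ℝ ℝ, volume] f₁) s -
        (φ.normed volume ⋆[ContinuousLinearMap.lsmul ℝ ℝ, volume] f₁) t := by
    have h1 : ∀ r, r ≤ a → deriv H r = 0 := by
      intro r hr
      rw [hder, φ.normed_eq_zero_of_le_abs, φ.normed_eq_zero_of_le_abs, sub_zero]
      · rw [abs_of_nonpos (by linarith)]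
        linarith
      · rw [abs_of_nonpos (by linarith)]
        linarith
    rw [setIntegral_eq_integral_of_forall_compl_eq_zero, hconv, hconv,
      ← integral_sub (hint s) (hint t)]
    · refine integral_congr_ae (.of_forall fun r => ?_)
      simp only
      rw [← mul_sub, ← hder]
      rcases le_or_gt r a with hr | hr
      · rw [h1 r hr, mul_zero, mul_zero]
      · rw [hf₁, Set.indicator_of_mem (by exact hr)]
    · intro r hr
      rw [h1 r ((not_lt.1 hr).trans ha.le), mul_zero]
  rw [← hI]
  refine (h.enorm_integral_profile_le hf hHd hHc hH00).trans ?_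
  have hm := measurableSet_norm_preimage (N := N) (measurableSet_Icc (a := s - ε) (b := t + ε))
  rw [radialFlux, withDensity_apply _ hm, ← lintegral_indicator hm]
  refine lintegral_mono fun x => ?_
  by_cases hx : ‖x‖ ∈ Set.Icc (s - ε) (t + ε)
  · rw [Set.indicator_of_mem (by exact hx)]
    exact mul_le_of_le_one_left' (hHle _)
  · rw [Set.indicator_of_notMem (by exact hx), hH0, enorm_zero, zero_mul]
    exact fun hx' => hx ⟨by linarith [hx'.1], by linarith [hx'.2]⟩

theorem HasWeakGradient.exists_profile_oscillation_le {N : ℕ} [NeZero N]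
    {u : EuclideanSpace ℝ (Fin N) → ℝ}
    {g : EuclideanSpace ℝ (Fin N) → EuclideanSpace ℝ (Fin N)} (h : HasWeakGradient u g)
    {f : ℝ → ℝ} (hf : u =ᵐ[volume] fun x => f ‖x‖) {a : ℝ} (ha : 0 < a) :
    ∃ D : Set ℝ, (∀ᵐ r, r ∈ D) ∧ ∀ s ∈ D, ∀ t ∈ D, a < s → s < t → ∀ ε > 0,
      N * volume (Metric.ball (0 : EuclideanSpace ℝ (Fin N)) 1) * ‖f s - f t‖ₑ ≤
        radialFlux g ((fun x => ‖x‖) ⁻¹' Set.Icc (s - ε) (t + ε)) := by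
  have hpos : ∀ n : ℕ, (0 : ℝ) < 1 / (n + 1) := fun n => by positivity
  let φ : ℕ → ContDiffBump (0 : ℝ) := fun n =>
    ⟨1 / (n + 1) / 2, 1 / (n + 1), half_pos (hpos n), half_lt_self (hpos n)⟩
  have hφ : Tendsto (fun n => (φ n).rOut) atTop (𝓝 0) := tendsto_one_div_add_atTop_nhds_zero_nat
  -- Cutting `f` off below `a` makes it locally integrable on the whole line; `D` is then the set of
  -- radii where the mollifications converge to it. The constant `2` is the ratio of the bump radii.
  have hae := ContDiffBump.ae_convolution_tendsto_right_of_locallyIntegrable (K := 2) hφ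
    (.of_forall fun n => by simp only [φ]; linarith)
    (locallyIntegrable_indicator_profile h.locallyIntegrable hf ha)
  refine ⟨_, hae, fun s hs t ht has hst ε hε => ?_⟩
  have hfs : (Set.Ioi a).indicator f s = f s := Set.indicator_of_mem (by exact has) f
  have hft : (Set.Ioi a).indicator f t = f t := Set.indicator_of_mem (by exact has.trans hst) f
  have hlim := (Filter.Tendsto.sub hs ht).enorm
  rw [hfs, hft] at hlim
  refine le_of_tendsto (ENNReal.Tendsto.const_mul hlim (Or.inr ?_)) ?_
  · exact ENNReal.mul_ne_top (ENNReal.natCast_ne_top _) measure_ball_lt_top.ne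
  · filter_upwards [hφ.eventually (Iic_mem_nhds hε),
      hφ.eventually (Iic_mem_nhds (sub_pos.2 has))] with n h1 h2
    exact h.enorm_convolution_sub_le hf ha hst (φ n) h1 h2

/-! ### The pointwise radial inequality -/

theorem volume_norm_Ioi_eq_top {N : ℕ} [NeZero N] (r : ℝ) :
    volume {x : EuclideanSpace ℝ (Fin N) | r < ‖x‖} = ⊤ := by
  have h : {x : EuclideanSpace ℝ (Fin N) | r < ‖x‖} = (Metric.closedBall 0 r)ᶜ := by
    ext x
    simp
  rw [h, measure_compl measurableSet_closedBall measure_closedBall_lt_top.ne,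
    measure_univ_of_isAddLeftInvariant]
  exact ENNReal.top_sub measure_closedBall_lt_top.ne

/-- This replaces decay at infinity: `{|u| ≥ A}` has finite measure, whereas the exterior of a ball
does not. -/
theorem MeasureTheory.MemLp.exists_profile_small {N : ℕ} [NeZero N]
    {u : EuclideanSpace ℝ (Fin N) → ℝ} {q : ℝ≥0∞} (hq0 : q ≠ 0) (hqt : q ≠ ⊤)
    (hu : MemLp u q volume) {f : ℝ → ℝ} (hf : u =ᵐ[volume] fun x => f ‖x‖) {D : Set ℝ}
    (hD : ∀ᵐ r, r ∈ D) (r : ℝ) {A : ℝ} (hA : 0 < A) : ∃ t ∈ D, r < t ∧ |f t| ≤ A := by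
  by_contra hc
  push Not at hc
  have h1 := hu.meas_ge_lt_top hq0 hqt (ε := A.toNNReal) (by simpa using hA)
  refine (h1.trans_le' ?_).ne (volume_norm_Ioi_eq_top (N := N) r)
  refine measure_mono_ae ?_
  filter_upwards [hf, ae_norm_of_ae hD] with x hx hxD hxr
  change A.toNNReal ≤ ‖u x‖₊
  rw [Real.toNNReal_le_iff_le_coe, coe_nnnorm, hx]
  exact (hc _ hxD hxr).le

theorem radialFlux_Icc_ge_of_forall {N : ℕ}
    {g : EuclideanSpace ℝ (Fin N) → EuclideanSpace ℝ (Fin N)} (hg : LocallyIntegrable g volume)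
    {r t : ℝ} (hr : 0 < r) {M : ℝ≥0∞}
    (h : ∀ ε > 0, M ≤ radialFlux g ((fun x => ‖x‖) ⁻¹' Set.Icc (r - ε) (t + ε))) :
    M ≤ radialFlux g ((fun x => ‖x‖) ⁻¹' Set.Icc r t) := by
  -- The factor `r / 2` keeps every annulus away from the origin, so the flux is finite and
  -- continuity from above applies.
  set ε : ℕ → ℝ := fun n => r / 2 * (1 / (n + 1)) with hε
  have hε0 : ∀ n, 0 < ε n := fun n => by positivity
  have hlim : Tendsto ε atTop (𝓝 0) := by
    simpa [hε] using (tendsto_one_div_add_atTop_nhds_zero_nat (𝕜 := ℝ)).const_mul (r / 2)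
  have hanti : Antitone ε := fun m n hmn => by
    simp only [hε]
    gcongr
  have hInter : ⋂ n, (fun x : EuclideanSpace ℝ (Fin N) => ‖x‖) ⁻¹'
      Set.Icc (r - ε n) (t + ε n) = (fun x => ‖x‖) ⁻¹' Set.Icc r t := by
    ext x
    simp only [Set.mem_iInter, Set.mem_preimage, Set.mem_Icc]
    refine ⟨fun hx => ⟨?_, ?_⟩, fun hx n => ⟨by linarith [hx.1, hε0 n], by linarith [hx.2, hε0 n]⟩⟩
    · refine le_of_tendsto (f := fun n => r - ε n) (by simpa using tendsto_const_nhds.sub hlim)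
        (.of_forall fun n => (hx n).1)
    · refine ge_of_tendsto (f := fun n => t + ε n) (by simpa using tendsto_const_nhds.add hlim)
        (.of_forall fun n => (hx n).2)
  have := tendsto_measure_iInter_atTop (μ := radialFlux g)
    (s := fun n => (fun x : EuclideanSpace ℝ (Fin N) => ‖x‖) ⁻¹' Set.Icc (r - ε n) (t + ε n))
    (fun n => (measurableSet_norm_preimage measurableSet_Icc).nullMeasurableSet)
    (fun m n hmn => Set.preimage_mono (Set.Icc_subset_Icc (by linarith [hanti hmn])
      (by linarith [hanti hmn])))
    ⟨0, (radialFlux_Icc_lt_top hg (by simp [hε]; linarith)).ne⟩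
  rw [hInter] at this
  exact ge_of_tendsto this (.of_forall fun n => h _ (hε0 n))

theorem HasWeakGradient.ae_rpow_le_of_radial {N : ℕ} [NeZero N]
    {u : EuclideanSpace ℝ (Fin N) → ℝ}
    {g : EuclideanSpace ℝ (Fin N) → EuclideanSpace ℝ (Fin N)} (h : HasWeakGradient u g)
    (hrad : IsRadialAE u) {q : ℝ≥0∞} (hq0 : q ≠ 0) (hqt : q ≠ ⊤) (hu : MemLp u q volume)
    {p : ℝ} (hp : 1 ≤ p) {a : ℝ} (ha : 0 < a) :
    ∀ᵐ x, a < ‖x‖ → N * volume (Metric.ball (0 : EuclideanSpace ℝ (Fin N)) 1) * (‖u x‖ₑ / 2) ^ p ≤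
      ∫⁻ y in {y | ‖x‖ ≤ ‖y‖},
        ‖u y‖ₑ ^ (p - 1) * (‖g y‖ₑ * ENNReal.ofReal (‖y‖ * (‖y‖ ^ N)⁻¹)) := by
  obtain ⟨f, hf⟩ := hrad
  obtain ⟨D, hD, hosc⟩ := h.exists_profile_oscillation_le hf ha
  set ω : ℝ≥0∞ := N * volume (Metric.ball (0 : EuclideanSpace ℝ (Fin N)) 1) with hω
  filter_upwards [hf, ae_norm_of_ae hD] with x hx hxD hax
  rcases eq_or_ne (f ‖x‖) 0 with hzero | hne
  · rw [hx, hzero, enorm_zero, ENNReal.zero_div, ENNReal.zero_rpow_of_pos (by linarith), mul_zero]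
    exact zero_le
  set r := ‖x‖ with hr
  set A := |f r| / 2 with hAdef
  have hA : 0 < A := half_pos (abs_pos.2 hne)
  have hA' : ‖u x‖ₑ / 2 = ENNReal.ofReal A := by
    rw [hx, ← ofReal_norm, Real.norm_eq_abs, hAdef, ENNReal.ofReal_div_of_pos two_pos]
    simp
  -- The infimum `b` of `S` is a stopping radius: `|f|` loses at least `A` between `r` and points of
  -- `S` near `b`, yet exceeds `A` almost everywhere before `b`. Hence `A^(p-1)` may be replaced by
  -- `|u|^(p-1)` under the flux integral.
  set S : Set ℝ := {t | t ∈ D ∧ r < t ∧ |f t| ≤ A} with hS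
  have hSne : S.Nonempty := hu.exists_profile_small hq0 hqt hf hD r hA
  have hSbdd : BddBelow S := ⟨r, fun t ht => ht.2.1.le⟩
  set b := sInf S with hb
  have hflux : ω * ENNReal.ofReal A ≤ radialFlux g ((fun x => ‖x‖) ⁻¹' Set.Icc r b) := by
    refine radialFlux_Icc_ge_of_forall h.locallyIntegrable_grad (ha.trans hax) fun ε hε => ?_
    obtain ⟨t, ht, htb⟩ := exists_lt_of_csInf_lt hSne (lt_add_of_pos_right b (half_pos hε))
    refine le_trans ?_ ((hosc r hxD t ht.1 hax ht.2.1 (ε / 2) (half_pos hε)).trans (measure_mono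
      (Set.preimage_mono (Set.Icc_subset_Icc (by linarith) (by linarith)))))
    gcongr
    rw [← ofReal_norm, Real.norm_eq_abs]
    refine ENNReal.ofReal_le_ofReal ?_
    have := abs_sub_abs_le_abs_sub (f r) (f t)
    linarith [ht.2.2]
  have hm := measurableSet_norm_preimage (N := N) (measurableSet_Icc (a := r) (b := b))
  have hAt : ENNReal.ofReal A ^ (p - 1) ≠ ⊤ :=
    ENNReal.rpow_ne_top_of_nonneg (by linarith) ENNReal.ofReal_ne_top
  calc ω * (‖u x‖ₑ / 2) ^ p
      = ENNReal.ofReal A ^ (p - 1) * (ω * ENNReal.ofReal A) := by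
        have : ENNReal.ofReal A ^ p = ENNReal.ofReal A ^ (p - 1) * ENNReal.ofReal A := by
          conv_rhs => rw [← ENNReal.rpow_one (ENNReal.ofReal A), ← ENNReal.rpow_mul, one_mul]
          rw [← ENNReal.rpow_add _ _ (by simpa using hA) ENNReal.ofReal_ne_top, sub_add_cancel]
        rw [hA', this]
        ring
    _ ≤ ENNReal.ofReal A ^ (p - 1) * radialFlux g ((fun x => ‖x‖) ⁻¹' Set.Icc r b) := by gcongr
    _ = ∫⁻ y in (fun x => ‖x‖) ⁻¹' Set.Icc r b, ENNReal.ofReal A ^ (p - 1) *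
          (‖g y‖ₑ * ENNReal.ofReal (‖y‖ * (‖y‖ ^ N)⁻¹)) := by
        rw [radialFlux, withDensity_apply _ hm, lintegral_const_mul' _ _ hAt]
    _ ≤ ∫⁻ y in (fun x => ‖x‖) ⁻¹' Set.Icc r b, ‖u y‖ₑ ^ (p - 1) *
          (‖g y‖ₑ * ENNReal.ofReal (‖y‖ * (‖y‖ ^ N)⁻¹)) := by
        refine lintegral_mono_ae ((ae_restrict_iff' hm).2 ?_)
        filter_upwards [hf, ae_norm_of_ae hD, ae_norm_of_ae (Measure.ae_ne volume r),
          ae_norm_of_ae (Measure.ae_ne volume b)] with y hy hyD hyr hyb hmem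
        have h1 : ‖y‖ ∉ S := fun hyS => hyb (le_antisymm hmem.2 (csInf_le hSbdd hyS))
        have h2 : A < |f ‖y‖| := by
          by_contra hcon
          exact h1 ⟨hyD, lt_of_le_of_ne hmem.1 hyr.symm, not_lt.1 hcon⟩
        have h3 : ENNReal.ofReal A ≤ ‖u y‖ₑ := by
          rw [hy, ← ofReal_norm, Real.norm_eq_abs]
          exact ENNReal.ofReal_le_ofReal h2.le
        exact mul_le_mul' (ENNReal.rpow_le_rpow h3 (by linarith)) le_rfl
    _ ≤ _ := lintegral_mono_set fun y hy => hy.1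

/-! ### Trading powers of the potential, and bounds from the norm -/

/-- Since `β - δ ≤ 0`, the factor `v^(β-δ)` is largest at the lower bound for `v`. -/
theorem ofReal_rpow_mul_rpow_le {b r α β γ δ : ℝ} {v : ℝ≥0∞} (hb : 0 < b) (hr : 0 < r)
    (hv : v ≠ ⊤) (hlow : ENNReal.ofReal (b * r ^ (-γ)) ≤ v) (hδ : β ≤ δ) :
    ENNReal.ofReal (r ^ α) * v ^ β ≤
      ENNReal.ofReal (b ^ (β - δ)) * ENNReal.ofReal (r ^ (α + γ * (δ - β))) * v ^ δ := by
  lift v to NNReal using hv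
  have hlow' : b * r ^ (-γ) ≤ v := by
    rwa [← ENNReal.ofReal_coe_nnreal, ENNReal.ofReal_le_ofReal_iff (NNReal.coe_nonneg v)] at hlow
  have hbr : 0 < b * r ^ (-γ) := by positivity
  have hv : (0 : ℝ) < v := hbr.trans_le hlow'
  rw [← ENNReal.ofReal_coe_nnreal, ENNReal.ofReal_rpow_of_pos hv, ENNReal.ofReal_rpow_of_pos hv,
    ← ENNReal.ofReal_mul (by positivity), ← ENNReal.ofReal_mul (by positivity),
    ← ENNReal.ofReal_mul (by positivity)]
  refine ENNReal.ofReal_le_ofReal ?_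
  have h1 : (v : ℝ) ^ (β - δ) ≤ (b * r ^ (-γ)) ^ (β - δ) :=
    Real.rpow_le_rpow_of_nonpos hbr hlow' (by linarith)
  calc r ^ α * (v : ℝ) ^ β = r ^ α * ((v : ℝ) ^ (β - δ) * (v : ℝ) ^ δ) := by
        rw [← Real.rpow_add hv]
        congr 2
        ring
    _ ≤ r ^ α * ((b * r ^ (-γ)) ^ (β - δ) * (v : ℝ) ^ δ) := by gcongr
    _ = b ^ (β - δ) * r ^ (α + γ * (δ - β)) * (v : ℝ) ^ δ := by
        rw [Real.mul_rpow hb.le (by positivity), ← Real.rpow_mul hr.le, Real.rpow_add hr,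
          show -γ * (β - δ) = γ * (δ - β) by ring]
        ring

theorem rpow_mul_rpow_eq {p s : ℝ} (hp : 0 < p) (hs : 0 ≤ s) (v U : ℝ≥0∞) :
    (v * U ^ p) ^ (s / p) = v ^ (s / p) * U ^ s := by
  rw [ENNReal.mul_rpow_of_nonneg _ _ (by positivity), ← ENNReal.rpow_mul,
    mul_div_cancel₀ _ hp.ne']

theorem ConditionV.aemeasurable_comp_norm {N : ℕ} [NeZero N] {V : ℝ → ℝ≥0∞} (hV : ConditionV V) :
    AEMeasurable (fun x : EuclideanSpace ℝ (Fin N) => V ‖x‖) volume := by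
  classical
  have h1 : Measurable fun r : ℝ => if hr : r ∈ Set.Ioi (0 : ℝ) then
      (Set.Ioi (0 : ℝ)).domRestrict V ⟨r, hr⟩ else 0 :=
    Measurable.dite hV.measurable (g := fun _ => 0) measurable_const measurableSet_Ioi
  refine ⟨_, h1.comp measurable_norm, ?_⟩
  filter_upwards [Measure.ae_ne volume (0 : EuclideanSpace ℝ (Fin N))] with x hx
  have : ‖x‖ ∈ Set.Ioi (0 : ℝ) := norm_pos_iff.2 hx
  simp only [Function.comp_apply]
  rw [dif_pos this]
  rfl

theorem lintegral_eq_one_of_normW_eq_one {N : ℕ} {p : ℝ} (hp : 0 < p) {V : ℝ → ℝ≥0∞}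
    {u : EuclideanSpace ℝ (Fin N) → ℝ} (hu : normW p V u = 1) :
    ∫⁻ x, (‖weakGradient u x‖ₑ ^ p + V ‖x‖ * ‖u x‖ₑ ^ p) = 1 := by
  have h := congrArg (· ^ p) hu
  simpa only [normW, ← ENNReal.rpow_mul, one_div, inv_mul_cancel₀ hp.ne', ENNReal.rpow_one,
    ENNReal.one_rpow] using h

theorem lintegral_grad_le_one {N : ℕ} {p : ℝ} (hp : 0 < p) {V : ℝ → ℝ≥0∞}
    {u : EuclideanSpace ℝ (Fin N) → ℝ} (hu : normW p V u = 1) :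
    ∫⁻ x, ‖weakGradient u x‖ₑ ^ p ≤ 1 :=
  (lintegral_mono fun _ => le_self_add).trans (lintegral_eq_one_of_normW_eq_one hp hu).le

theorem lintegral_potential_le_one {N : ℕ} {p : ℝ} (hp : 0 < p) {V : ℝ → ℝ≥0∞}
    {u : EuclideanSpace ℝ (Fin N) → ℝ} (hu : normW p V u = 1) :
    ∫⁻ x, V ‖x‖ * ‖u x‖ₑ ^ p ≤ 1 :=
  (lintegral_mono fun _ => le_add_self).trans (lintegral_eq_one_of_normW_eq_one hp hu).le

theorem MemW.aemeasurable_potential {N : ℕ} [NeZero N] {p : ℝ} {V : ℝ → ℝ≥0∞} (hV : ConditionV V)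
    {u : EuclideanSpace ℝ (Fin N) → ℝ} (hu : MemW p V u) :
    AEMeasurable (fun x => V ‖x‖ * ‖u x‖ₑ ^ p) volume :=
  hV.aemeasurable_comp_norm.mul (hu.1.memLp.aestronglyMeasurable.enorm.pow_const p)

theorem hasWeakGradient_weakGradient {N : ℕ} {u : EuclideanSpace ℝ (Fin N) → ℝ}
    (h : ∃ g, HasWeakGradient u g) : HasWeakGradient u (weakGradient u) := by
  rw [weakGradient, dif_pos h]
  exact h.choose_spec

theorem setLIntegral_rpow_mul_rpow_le_one {X : Type*} [MeasurableSpace X] {μ : Measure X}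
    {F G : X → ℝ≥0∞} (hF : AEMeasurable F μ) (hG : AEMeasurable G μ) (hF1 : ∫⁻ x, F x ∂μ ≤ 1)
    (hG1 : ∫⁻ x, G x ∂μ ≤ 1) {p : ℝ} (hp : 1 < p) (s : Set X) :
    ∫⁻ x in s, F x ^ ((p - 1) / p) * G x ^ (1 / p) ∂μ ≤ 1 := by
  have h1 : 0 ≤ (p - 1) / p := div_nonneg (by linarith) (by linarith)
  have h2 : 0 ≤ 1 / p := div_nonneg zero_le_one (by linarith)
  calc _ ≤ ∫⁻ x, F x ^ ((p - 1) / p) * G x ^ (1 / p) ∂μ := setLIntegral_le_lintegral _ _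
    _ ≤ _ := ENNReal.lintegral_mul_norm_pow_le hF hG h1 h2 (by field_simp; ring)
    _ ≤ 1 := mul_le_one' (ENNReal.rpow_le_one hF1 h1) (ENNReal.rpow_le_one hG1 h2)

/-! ### Decay of radial functions -/

theorem exists_radial_decay {N : ℕ} [NeZero N] {p : ℝ} (hp : 1 < p) (hpN : p < N) {V : ℝ → ℝ≥0∞}
    (hV : ConditionV V) {R₂ b γ : ℝ} (hR₂ : 0 < R₂) (hb : 0 < b) (hγ : γ ≤ p)
    (hlow : ∀ᵐ r : ℝ, R₂ < r → V r ≠ ⊤ ∧ ENNReal.ofReal (b * r ^ (-γ)) ≤ V r) :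
    ∃ C : ℝ≥0∞, C ≠ ⊤ ∧ ∀ u : EuclideanSpace ℝ (Fin N) → ℝ, MemWr p V u → normW p V u = 1 →
      ∀ᵐ x, R₂ < ‖x‖ →
        ‖u x‖ₑ ≤ C * ENNReal.ofReal (‖x‖ ^ (-((N - 1 - γ * ((p - 1) / p)) / p))) := by
  have hp0 : 0 < p := by linarith
  set δ := (p - 1) / p with hδdef
  have hδ : 0 ≤ δ := div_nonneg (by linarith) hp0.le
  have hδp : δ * p = p - 1 := by rw [hδdef]; field_simp
  set θ := N - 1 - γ * δ with hθdef
  -- Indeed `γδ ≤ p - 1 < N - 1`. The sign allows `|y|^(-θ)` to be bounded by `|x|^(-θ)` on `|y| ≥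
  -- |x|`.
  have hθ : 0 ≤ θ := by nlinarith
  set ω : ℝ≥0∞ := N * volume (Metric.ball (0 : EuclideanSpace ℝ (Fin N)) 1) with hω
  have hω0 : ω ≠ 0 :=
    mul_ne_zero (by simp [NeZero.ne N]) (Metric.measure_ball_pos volume _ one_pos).ne'
  have hωt : ω ≠ ⊤ := ENNReal.mul_ne_top (ENNReal.natCast_ne_top _) measure_ball_lt_top.ne
  set C₁ := ENNReal.ofReal (b ^ (0 - δ)) with hC₁
  refine ⟨2 * (ω⁻¹ * C₁) ^ p⁻¹, ENNReal.mul_ne_top ENNReal.ofNat_ne_top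
    (ENNReal.rpow_ne_top_of_nonneg (inv_nonneg.2 hp0.le)
      (ENNReal.mul_ne_top (ENNReal.inv_ne_top.2 hω0) ENNReal.ofReal_ne_top)), ?_⟩
  intro u hu hu1
  have hq : 0 < p * N / (N - p) := div_pos (mul_pos hp0 (hp0.trans hpN)) (by linarith)
  filter_upwards [(hasWeakGradient_weakGradient hu.1.1.exists_grad).ae_rpow_le_of_radial hu.2
    (by simpa using hq) ENNReal.ofReal_ne_top hu.1.1.memLp hp.le hR₂] with x hx hxR
  have hx0 : 0 < ‖x‖ := hR₂.trans hxR
  have hm : MeasurableSet {y : EuclideanSpace ℝ (Fin N) | ‖x‖ ≤ ‖y‖} :=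
    measurableSet_norm_preimage measurableSet_Ici
  have hbound : ω * (‖u x‖ₑ / 2) ^ p ≤ C₁ * ENNReal.ofReal (‖x‖ ^ (-θ)) := by
    refine (hx hxR).trans ?_
    calc _ ≤ ∫⁻ y in {y | ‖x‖ ≤ ‖y‖}, C₁ * ENNReal.ofReal (‖x‖ ^ (-θ)) *
          ((V ‖y‖ * ‖u y‖ₑ ^ p) ^ ((p - 1) / p) * (‖weakGradient u y‖ₑ ^ p) ^ (1 / p)) := by
          refine lintegral_mono_ae ((ae_restrict_iff' hm).2 ?_)
          filter_upwards [ae_norm_of_ae hlow] with y hy hxy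
          have hyR : R₂ < ‖y‖ := hxR.trans_le hxy
          have hy0 : 0 < ‖y‖ := hR₂.trans hyR
          obtain ⟨hVt, hVl⟩ := hy hyR
          -- The factor `V^δ`, created from nothing, completes `|u|^(p-1)` to `(V|u|^p)^((p-1)/p)`,
          -- ready for Hölder with the gradient.
          have h1 := ofReal_rpow_mul_rpow_le (α := 1 - N) (β := 0) (δ := δ) hb hy0 hVt hVl hδ
          have h2 : ‖y‖ * (‖y‖ ^ N)⁻¹ = ‖y‖ ^ (1 - N : ℝ) := by
            rw [Real.rpow_sub hy0, Real.rpow_one, Real.rpow_natCast, div_eq_mul_inv]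
          have h3 : ‖y‖ ^ (1 - N + γ * (δ - 0)) ≤ ‖x‖ ^ (-θ) := by
            rw [show 1 - N + γ * (δ - 0) = -θ by rw [hθdef]; ring]
            exact Real.rpow_le_rpow_of_nonpos hx0 hxy (by linarith)
          rw [ENNReal.rpow_zero, mul_one] at h1
          rw [rpow_mul_rpow_eq hp0 (by linarith), ← ENNReal.rpow_mul, mul_one_div_cancel hp0.ne',
            ENNReal.rpow_one, h2]
          calc _ ≤ ‖u y‖ₑ ^ (p - 1) * (‖weakGradient u y‖ₑ *
                (C₁ * ENNReal.ofReal (‖x‖ ^ (-θ)) * V ‖y‖ ^ δ)) := by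
                gcongr
                exact h1.trans (by gcongr)
            _ = _ := by ring
      _ = C₁ * ENNReal.ofReal (‖x‖ ^ (-θ)) * ∫⁻ y in {y | ‖x‖ ≤ ‖y‖},
          ((V ‖y‖ * ‖u y‖ₑ ^ p) ^ ((p - 1) / p) * (‖weakGradient u y‖ₑ ^ p) ^ (1 / p)) :=
          lintegral_const_mul' _ _ (ENNReal.mul_ne_top ENNReal.ofReal_ne_top ENNReal.ofReal_ne_top)
      _ ≤ _ := mul_le_of_le_one_right' (setLIntegral_rpow_mul_rpow_le_one
          (hu.1.aemeasurable_potential hV)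
          (hu.1.1.memLp_grad.aestronglyMeasurable.enorm.pow_const p)
          (lintegral_potential_le_one hp0 hu1) (lintegral_grad_le_one hp0 hu1) hp _)
  have h4 : (‖u x‖ₑ / 2) ^ p ≤ ω⁻¹ * C₁ * ENNReal.ofReal (‖x‖ ^ (-θ)) := by
    calc (‖u x‖ₑ / 2) ^ p = ω⁻¹ * (ω * (‖u x‖ₑ / 2) ^ p) := by
          rw [← mul_assoc, ENNReal.inv_mul_cancel hω0 hωt, one_mul]
      _ ≤ ω⁻¹ * (C₁ * ENNReal.ofReal (‖x‖ ^ (-θ))) := by gcongr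
      _ = _ := (mul_assoc _ _ _).symm
  have h5 := ENNReal.rpow_le_rpow h4 (inv_nonneg.2 hp0.le)
  rw [ENNReal.rpow_rpow_inv hp0.ne', ENNReal.mul_rpow_of_nonneg _ _ (inv_nonneg.2 hp0.le),
    ENNReal.ofReal_rpow_of_pos (by positivity), ← Real.rpow_mul hx0.le, ← div_eq_mul_inv,
    neg_div, ENNReal.div_le_iff_le_mul (by simp) (by simp)] at h5
  refine h5.trans_eq ?_
  ring

/-! ### Tail estimates in the two ranges of `q` -/

theorem mem_compl_ball_zero_iff {N : ℕ} {x : EuclideanSpace ℝ (Fin N)} {R : ℝ} :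
    x ∈ (Metric.ball (0 : EuclideanSpace ℝ (Fin N)) R)ᶜ ↔ R ≤ ‖x‖ := by
  simp

theorem exists_lintegral_compl_ball_rpow_le {N : ℕ} {τ : ℝ} (hτ : τ < -N) :
    ∃ C : ℝ≥0∞, C ≠ ⊤ ∧ ∃ σ : ℝ, 0 < σ ∧ ∀ R : ℝ, 1 ≤ R →
      ∫⁻ x in (Metric.ball (0 : EuclideanSpace ℝ (Fin N)) R)ᶜ, ENNReal.ofReal (‖x‖ ^ τ) ≤
        C * ENNReal.ofReal (R ^ (-σ)) := by
  -- The midpoint of `N` and `-τ`: in `τ = -σ - m` the part `m > N` secures integrability and `σ >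
  -- 0` gives decay in `R`. The factor `2^m` comes from `1 + |x| ≤ 2|x|`.
  set m : ℝ := (N - τ) / 2 with hm
  set σ : ℝ := (-N - τ) / 2 with hσ
  have hmN : N < m := by rw [hm]; linarith
  have hm0 : 0 ≤ m := (Nat.cast_nonneg N).trans hmN.le
  have hfin := finite_integral_one_add_norm (E := EuclideanSpace ℝ (Fin N)) (μ := volume) (r := m)
    (by simpa using hmN)
  refine ⟨ENNReal.ofReal (2 ^ m) * ∫⁻ x : EuclideanSpace ℝ (Fin N),
    ENNReal.ofReal ((1 + ‖x‖) ^ (-m)), ENNReal.mul_ne_top ENNReal.ofReal_ne_top hfin.ne,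
    σ, by rw [hσ]; linarith, fun R hR => ?_⟩
  have hR0 : 0 < R := by linarith
  calc _ ≤ ∫⁻ x in (Metric.ball (0 : EuclideanSpace ℝ (Fin N)) R)ᶜ,
        ENNReal.ofReal (R ^ (-σ) * 2 ^ m) * ENNReal.ofReal ((1 + ‖x‖) ^ (-m)) := by
        refine setLIntegral_mono' measurableSet_ball.compl fun x hx => ?_
        rw [mem_compl_ball_zero_iff] at hx
        have hx0 : 0 < ‖x‖ := hR0.trans_le hx
        rw [← ENNReal.ofReal_mul (by positivity)]
        refine ENNReal.ofReal_le_ofReal ?_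
        have h1 : ‖x‖ ^ (-m) ≤ ((1 + ‖x‖) / 2) ^ (-m) :=
          Real.rpow_le_rpow_of_nonpos (by positivity) (by linarith) (by linarith)
        have h2 : ‖x‖ ^ (-σ) ≤ R ^ (-σ) :=
          Real.rpow_le_rpow_of_nonpos hR0 hx (by rw [hσ]; linarith)
        rw [Real.div_rpow (by positivity) two_pos.le, Real.rpow_neg two_pos.le, div_inv_eq_mul] at h1
        calc ‖x‖ ^ τ = ‖x‖ ^ (-σ) * ‖x‖ ^ (-m) := by
              rw [← Real.rpow_add hx0]
              congr 1
              rw [hσ, hm]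
              ring
          _ ≤ R ^ (-σ) * ((1 + ‖x‖) ^ (-m) * 2 ^ m) := by gcongr
          _ = _ := by ring
    _ = ENNReal.ofReal (R ^ (-σ) * 2 ^ m) *
        ∫⁻ x in (Metric.ball (0 : EuclideanSpace ℝ (Fin N)) R)ᶜ,
          ENNReal.ofReal ((1 + ‖x‖) ^ (-m)) := lintegral_const_mul' _ _ ENNReal.ofReal_ne_top
    _ ≤ ENNReal.ofReal (R ^ (-σ) * 2 ^ m) *
        ∫⁻ x : EuclideanSpace ℝ (Fin N), ENNReal.ofReal ((1 + ‖x‖) ^ (-m)) := by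
        gcongr
        exact Measure.restrict_le_self
    _ = _ := by
        rw [ENNReal.ofReal_mul (by positivity)]
        ring

theorem tendsto_RInfty_of_le {N : ℕ} {p : ℝ} {V : ℝ → ℝ≥0∞} {K : ℝ → ℝ} {q R₀ σ : ℝ} {C : ℝ≥0∞}
    (hC : C ≠ ⊤) (hσ : 0 < σ)
    (h : ∀ R, R₀ < R → ∀ u h : EuclideanSpace ℝ (Fin N) → ℝ, MemWr p V u → MemW p V h →
      normW p V u = 1 → normW p V h = 1 →
      ∫⁻ x in (Metric.ball (0 : EuclideanSpace ℝ (Fin N)) R)ᶜ,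
        ENNReal.ofReal (K ‖x‖) * ‖u x‖ₑ ^ (q - 1) * ‖h x‖ₑ ≤ C * ENNReal.ofReal (R ^ (-σ))) :
    Tendsto (fun R : ℝ => RInfty N p V K q R) atTop (𝓝 0) := by
  have h1 : Tendsto (fun R : ℝ => C * ENNReal.ofReal (R ^ (-σ))) atTop (𝓝 0) := by
    have h2 := ENNReal.tendsto_ofReal (tendsto_rpow_neg_atTop hσ)
    rw [ENNReal.ofReal_zero] at h2
    simpa using ENNReal.Tendsto.const_mul h2 (Or.inr hC)
  refine tendsto_of_tendsto_of_tendsto_of_le_of_le' tendsto_const_nhds h1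
    (.of_forall fun _ => zero_le) ?_
  filter_upwards [eventually_gt_atTop R₀] with R hR
  exact iSup_le fun u => iSup_le fun w => iSup_le fun hu => iSup_le fun hw => iSup_le fun hu1 =>
    iSup_le fun hw1 => h R hR u w hu hw hu1 hw1

/-- Split `|u|^(q-1) = |u|^(q-p) |u|^(p-1)`: radial decay handles the first factor, and Hölder with
weight `V` the second together with `h`. -/
theorem tendsto_RInfty_of_le_exponent {N : ℕ} [NeZero N] {p : ℝ} (hp : 1 < p) (hpN : p < N)
    {V : ℝ → ℝ≥0∞} {K : ℝ → ℝ} (hV : ConditionV V) {R₂ b α β γ q : ℝ} {Λ : ℝ≥0∞} (hR₂ : 0 < R₂)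
    (hb : 0 < b) (hβ : β ≤ 1) (hγ : γ ≤ p) (hΛ : Λ ≠ ⊤)
    (hlow : ∀ᵐ r : ℝ, R₂ < r → V r ≠ ⊤ ∧ ENNReal.ofReal (b * r ^ (-γ)) ≤ V r)
    (hK : ∀ᵐ r : ℝ, R₂ < r → ENNReal.ofReal (K r) ≤ Λ * (ENNReal.ofReal (r ^ α) * V r ^ β))
    (hpq : p ≤ q) (hq : qLowerStarStar N p α β γ < q) :
    Tendsto (fun R : ℝ => RInfty N p V K q R) atTop (𝓝 0) := by
  have hp0 : 0 < p := by linarith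
  obtain ⟨C, hC, hdecay⟩ := exists_radial_decay hp hpN hV hR₂ hb hγ hlow
  set ν := (N - 1 - γ * ((p - 1) / p)) / p with hν
  set s := α + γ * (1 - β) with hs
  -- The remaining exponent of `|x|` is `s - ν(q - p)`; its negativity is `q > q_**` with
  -- denominators cleared.
  have hσ : 0 < -(s - ν * (q - p)) := by
    have hD : 0 < p * (N - 1) - γ * (p - 1) := by nlinarith
    have h1 : ν = (p * (N - 1) - γ * (p - 1)) / (p * p) := by
      rw [hν]
      field_simp
    rw [qLowerStarStar, ← mul_div_assoc, div_lt_iff₀ hD] at hq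
    have h2 : -(s - ν * (q - p)) =
        ((p * (N - 1) - γ * (p - 1)) * (q - p) - p * p * s) / (p * p) := by
      rw [h1]
      field_simp
      ring
    rw [h2]
    refine div_pos ?_ (by positivity)
    rw [hs]
    linarith
  set B := Λ * ENNReal.ofReal (b ^ (β - 1)) * C ^ (q - p) with hB
  have hBt : B ≠ ⊤ := ENNReal.mul_ne_top (ENNReal.mul_ne_top hΛ ENNReal.ofReal_ne_top)
    (ENNReal.rpow_ne_top_of_nonneg (by linarith) hC)
  refine tendsto_RInfty_of_le (R₀ := R₂) hBt hσ fun R hR u h hu hh hu1 hh1 => ?_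
  have hR0 : 0 < R := hR₂.trans hR
  calc _ ≤ ∫⁻ x in (Metric.ball (0 : EuclideanSpace ℝ (Fin N)) R)ᶜ,
        B * ENNReal.ofReal (R ^ (-(-(s - ν * (q - p))))) *
          ((V ‖x‖ * ‖u x‖ₑ ^ p) ^ ((p - 1) / p) * (V ‖x‖ * ‖h x‖ₑ ^ p) ^ (1 / p)) := by
        refine lintegral_mono_ae ((ae_restrict_iff' measurableSet_ball.compl).2 ?_)
        filter_upwards [ae_norm_of_ae hlow, ae_norm_of_ae hK, hdecay u hu hu1] with x h1 h2 h3 hx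
        rw [mem_compl_ball_zero_iff] at hx
        have hxR := hR.trans_le hx
        have hx0 : 0 < ‖x‖ := hR₂.trans hxR
        obtain ⟨hVt, hVl⟩ := h1 hxR
        have h4 := ofReal_rpow_mul_rpow_le (α := α) hb hx0 hVt hVl hβ
        have h5 : ‖u x‖ₑ ^ (q - p) ≤ C ^ (q - p) * ENNReal.ofReal (‖x‖ ^ (-ν * (q - p))) := by
          refine (ENNReal.rpow_le_rpow (h3 hxR) (by linarith)).trans_eq ?_
          rw [ENNReal.mul_rpow_of_nonneg _ _ (by linarith),
            ENNReal.ofReal_rpow_of_pos (by positivity), ← Real.rpow_mul hx0.le]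
        have h6 : ENNReal.ofReal (‖x‖ ^ s) * ENNReal.ofReal (‖x‖ ^ (-ν * (q - p))) ≤
            ENNReal.ofReal (R ^ (-(-(s - ν * (q - p))))) := by
          rw [← ENNReal.ofReal_mul (by positivity), ← Real.rpow_add hx0]
          refine ENNReal.ofReal_le_ofReal ?_
          rw [show s + -ν * (q - p) = -(-(s - ν * (q - p))) by ring]
          exact Real.rpow_le_rpow_of_nonpos hR0 hx (by linarith)
        have h7 : V ‖x‖ = V ‖x‖ ^ ((p - 1) / p) * V ‖x‖ ^ (1 / p) := by
          rw [← ENNReal.rpow_add_of_nonneg _ _ (div_nonneg (by linarith) hp0.le) (by positivity),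
            ← add_div, sub_add_cancel, div_self hp0.ne', ENNReal.rpow_one]
        rw [rpow_mul_rpow_eq hp0 (by linarith), rpow_mul_rpow_eq hp0 zero_le_one, ENNReal.rpow_one,
          show q - 1 = (q - p) + (p - 1) by ring,
          ENNReal.rpow_add_of_nonneg _ _ (by linarith) (by linarith)]
        rw [ENNReal.rpow_one] at h4
        calc _ ≤ (Λ * (ENNReal.ofReal (b ^ (β - 1)) * ENNReal.ofReal (‖x‖ ^ s) * V ‖x‖)) *
              (C ^ (q - p) * ENNReal.ofReal (‖x‖ ^ (-ν * (q - p))) * ‖u x‖ₑ ^ (p - 1)) *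
                ‖h x‖ₑ := by
              gcongr
              exact (h2 hxR).trans (by gcongr)
          _ = B * (ENNReal.ofReal (‖x‖ ^ s) * ENNReal.ofReal (‖x‖ ^ (-ν * (q - p)))) *
              (V ‖x‖ * (‖u x‖ₑ ^ (p - 1) * ‖h x‖ₑ)) := by
              rw [hB]
              ring
          _ ≤ B * ENNReal.ofReal (R ^ (-(-(s - ν * (q - p))))) *
              (V ‖x‖ * (‖u x‖ₑ ^ (p - 1) * ‖h x‖ₑ)) := by gcongr
          _ = _ := by
              nth_rw 1 [h7]
              ring
    _ = B * ENNReal.ofReal (R ^ (-(-(s - ν * (q - p))))) *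
        ∫⁻ x in (Metric.ball (0 : EuclideanSpace ℝ (Fin N)) R)ᶜ,
          ((V ‖x‖ * ‖u x‖ₑ ^ p) ^ ((p - 1) / p) * (V ‖x‖ * ‖h x‖ₑ ^ p) ^ (1 / p)) :=
        lintegral_const_mul' _ _ (ENNReal.mul_ne_top hBt ENNReal.ofReal_ne_top)
    _ ≤ _ := mul_le_of_le_one_right' (setLIntegral_rpow_mul_rpow_le_one
        (hu.1.aemeasurable_potential hV) (hh.aemeasurable_potential hV)
        (lintegral_potential_le_one hp0 hu1) (lintegral_potential_le_one hp0 hh1) hp _)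

/-- No pointwise decay is needed: three-factor Hölder with exponents `(q-1)/p`, `1/p`, `(p-q)/p`
applies, and smallness comes from the tail of the pure power. -/
theorem tendsto_RInfty_of_exponent_lt {N : ℕ} [NeZero N] {p : ℝ} (hp : 1 < p) (hpN : p < N)
    {V : ℝ → ℝ≥0∞} {K : ℝ → ℝ} (hV : ConditionV V) {R₂ b α β γ q : ℝ} {Λ : ℝ≥0∞} (hR₂ : 0 < R₂)
    (hb : 0 < b) (hγ : γ ≤ p) (hΛ : Λ ≠ ⊤)
    (hlow : ∀ᵐ r : ℝ, R₂ < r → V r ≠ ⊤ ∧ ENNReal.ofReal (b * r ^ (-γ)) ≤ V r)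
    (hK : ∀ᵐ r : ℝ, R₂ < r → ENNReal.ofReal (K r) ≤ Λ * (ENNReal.ofReal (r ^ α) * V r ^ β))
    (hqp : q < p) (hq1 : 1 < q) (hβq : p * β < q) (hq : qLowerStar N p α β γ < q) :
    Tendsto (fun R : ℝ => RInfty N p V K q R) atTop (𝓝 0) := by
  have hp0 : 0 < p := by linarith
  set s := α + γ * (q / p - β) with hs
  set τ := s * (p / (p - q)) with hτdef
  -- With denominators cleared this is `q > q_*`.
  have hτ : τ < -N := by
    rw [qLowerStar, ← mul_div_assoc, div_lt_iff₀ (by linarith)] at hq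
    rw [hτdef, ← mul_div_assoc, div_lt_iff₀ (by linarith)]
    have : s * p = α * p + γ * (q - β * p) := by
      rw [hs]
      field_simp
    rw [this]
    linarith
  obtain ⟨C, hC, σ, hσ, htail⟩ := exists_lintegral_compl_ball_rpow_le hτ
  set e := (p - q) / p with he
  have he0 : 0 < e := div_pos (by linarith) hp0
  have hδ : β ≤ q / p := by
    rw [le_div_iff₀ hp0]
    linarith
  set B := Λ * ENNReal.ofReal (b ^ (β - q / p)) with hB
  have hBt : B ≠ ⊤ := ENNReal.mul_ne_top hΛ ENNReal.ofReal_ne_top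
  have hBC : B * C ^ e ≠ ⊤ := ENNReal.mul_ne_top hBt (ENNReal.rpow_ne_top_of_nonneg he0.le hC)
  refine tendsto_RInfty_of_le (R₀ := max R₂ 1) hBC (mul_pos hσ he0)
    fun R hR u h hu hh hu1 hh1 => ?_
  have hR2 : R₂ < R := (le_max_left _ _).trans_lt hR
  have hR1 : 1 < R := (le_max_right _ _).trans_lt hR
  have hR0 : 0 < R := hR₂.trans hR2
  set F : Fin 3 → EuclideanSpace ℝ (Fin N) → ℝ≥0∞ :=
    ![fun x => V ‖x‖ * ‖u x‖ₑ ^ p, fun x => V ‖x‖ * ‖h x‖ₑ ^ p,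
      fun x => ENNReal.ofReal (‖x‖ ^ τ)] with hF
  set c : Fin 3 → ℝ := ![(q - 1) / p, 1 / p, e] with hc
  have hFm : ∀ i ∈ Finset.univ, AEMeasurable (F i)
      (volume.restrict (Metric.ball (0 : EuclideanSpace ℝ (Fin N)) R)ᶜ) := by
    intro i _
    fin_cases i
    · exact (hu.1.aemeasurable_potential hV).restrict
    · exact (hh.aemeasurable_potential hV).restrict
    · exact (by fun_prop : Measurable fun x : EuclideanSpace ℝ (Fin N) =>
        ENNReal.ofReal (‖x‖ ^ τ)).aemeasurable
  have hc0 : ∀ i ∈ Finset.univ, 0 ≤ c i := by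
    intro i _
    fin_cases i
    · exact div_nonneg (by linarith) hp0.le
    · exact div_nonneg zero_le_one hp0.le
    · exact he0.le
  have hc1 : ∑ i ∈ Finset.univ, c i = 1 := by
    simp only [hc, he, Fin.sum_univ_three, Matrix.cons_val]
    field_simp
    ring
  have hholder := ENNReal.lintegral_prod_norm_pow_le Finset.univ hFm hc1 hc0
  simp only [Fin.prod_univ_three, hF, hc, Matrix.cons_val] at hholder
  calc _ ≤ ∫⁻ x in (Metric.ball (0 : EuclideanSpace ℝ (Fin N)) R)ᶜ,
        B * ((V ‖x‖ * ‖u x‖ₑ ^ p) ^ ((q - 1) / p) * (V ‖x‖ * ‖h x‖ₑ ^ p) ^ (1 / p) *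
          ENNReal.ofReal (‖x‖ ^ τ) ^ e) := by
        refine lintegral_mono_ae ((ae_restrict_iff' measurableSet_ball.compl).2 ?_)
        filter_upwards [ae_norm_of_ae hlow, ae_norm_of_ae hK] with x h1 h2 hx
        rw [mem_compl_ball_zero_iff] at hx
        have hxR := hR2.trans_le hx
        have hx0 : 0 < ‖x‖ := hR₂.trans hxR
        obtain ⟨hVt, hVl⟩ := h1 hxR
        have h4 := ofReal_rpow_mul_rpow_le (α := α) hb hx0 hVt hVl hδ
        have h5 : ENNReal.ofReal (‖x‖ ^ τ) ^ e = ENNReal.ofReal (‖x‖ ^ s) := by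
          rw [ENNReal.ofReal_rpow_of_pos (by positivity), ← Real.rpow_mul hx0.le, hτdef, he]
          congr 2
          have : p - q ≠ 0 := by linarith
          field_simp
        have h7 : V ‖x‖ ^ (q / p) = V ‖x‖ ^ ((q - 1) / p) * V ‖x‖ ^ (1 / p) := by
          rw [← ENNReal.rpow_add_of_nonneg _ _ (div_nonneg (by linarith) hp0.le) (by positivity),
            ← add_div, sub_add_cancel]
        rw [rpow_mul_rpow_eq hp0 (by linarith), rpow_mul_rpow_eq hp0 zero_le_one, ENNReal.rpow_one,
          h5]
        calc _ ≤ (Λ * (ENNReal.ofReal (b ^ (β - q / p)) * ENNReal.ofReal (‖x‖ ^ s) *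
              V ‖x‖ ^ (q / p))) * ‖u x‖ₑ ^ (q - 1) * ‖h x‖ₑ := by
              gcongr
              exact (h2 hxR).trans (by gcongr)
          _ = _ := by
              rw [h7, hB]
              ring
    _ = B * ∫⁻ x in (Metric.ball (0 : EuclideanSpace ℝ (Fin N)) R)ᶜ,
        ((V ‖x‖ * ‖u x‖ₑ ^ p) ^ ((q - 1) / p) * (V ‖x‖ * ‖h x‖ₑ ^ p) ^ (1 / p) *
          ENNReal.ofReal (‖x‖ ^ τ) ^ e) := lintegral_const_mul' _ _ hBt
    _ ≤ B * (1 * 1 * (C * ENNReal.ofReal (R ^ (-σ))) ^ e) := by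
        refine mul_le_mul' le_rfl (hholder.trans ?_)
        gcongr
        · exact ENNReal.rpow_le_one ((setLIntegral_le_lintegral _ _).trans
            (lintegral_potential_le_one hp0 hu1)) (div_nonneg (by linarith) hp0.le)
        · exact ENNReal.rpow_le_one ((setLIntegral_le_lintegral _ _).trans
            (lintegral_potential_le_one hp0 hh1)) (by positivity)
        · exact htail R hR1.le
    _ = _ := by
        rw [ENNReal.mul_rpow_of_nonneg _ _ he0.le, ENNReal.ofReal_rpow_of_pos (by positivity),
          ← Real.rpow_mul hR0.le, neg_mul]
        ring

/-! ### From essential bounds to pointwise bounds, and the theorem -/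

theorem exists_potential_lower_bound {V : ℝ → ℝ≥0∞} {R₂ γ : ℝ} (hR₂ : 0 < R₂)
    (hVfin : ∀ᵐ r ∂(volume.restrict (Set.Ioi R₂)), V r < ⊤)
    (hgrowth : 0 < essInf (fun r : ℝ => ENNReal.ofReal (r ^ γ) * V r)
      (volume.restrict (Set.Ioi R₂))) :
    ∃ b > 0, ∀ᵐ r : ℝ, R₂ < r → V r ≠ ⊤ ∧ ENNReal.ofReal (b * r ^ (-γ)) ≤ V r := by
  -- A value strictly below the essential infimum is finite even when the infimum is `∞`.
  obtain ⟨c, hc0, hc⟩ := exists_between hgrowth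
  have hct : c ≠ ⊤ := hc.ne_top
  refine ⟨c.toReal, ENNReal.toReal_pos hc0.ne' hct, ?_⟩
  filter_upwards [(ae_restrict_iff' measurableSet_Ioi).1 hVfin,
    (ae_restrict_iff' measurableSet_Ioi).1 (ae_lt_of_lt_essInf hc)] with r h1 h2 hr
  have hr0 : 0 < r := hR₂.trans hr
  refine ⟨(h1 hr).ne, ?_⟩
  rw [ENNReal.ofReal_mul ENNReal.toReal_nonneg, ENNReal.ofReal_toReal hct]
  calc c * ENNReal.ofReal (r ^ (-γ))
      ≤ ENNReal.ofReal (r ^ γ) * V r * ENNReal.ofReal (r ^ (-γ)) := by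
        gcongr
        exact (h2 hr).le
    _ = ENNReal.ofReal (r ^ γ * r ^ (-γ)) * V r := by
        rw [ENNReal.ofReal_mul (by positivity)]
        ring
    _ = V r := by
        rw [← Real.rpow_add hr0, add_neg_cancel, Real.rpow_zero, ENNReal.ofReal_one, one_mul]

theorem ae_le_essSup_div_mul {V : ℝ → ℝ≥0∞} {K : ℝ → ℝ} {R₂ b α β γ : ℝ} (hR₂ : 0 < R₂)
    (hb : 0 < b) (hlow : ∀ᵐ r : ℝ, R₂ < r → V r ≠ ⊤ ∧ ENNReal.ofReal (b * r ^ (-γ)) ≤ V r) :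
    ∀ᵐ r : ℝ, R₂ < r → ENNReal.ofReal (K r) ≤
      essSup (fun r : ℝ => ENNReal.ofReal (K r) / (ENNReal.ofReal (r ^ α) * V r ^ β))
        (volume.restrict (Set.Ioi R₂)) * (ENNReal.ofReal (r ^ α) * V r ^ β) := by
  filter_upwards [hlow, (ae_restrict_iff' measurableSet_Ioi).1 (ENNReal.ae_le_essSup
    fun r : ℝ => ENNReal.ofReal (K r) / (ENNReal.ofReal (r ^ α) * V r ^ β))] with r h1 h2 hr
  have hr0 : 0 < r := hR₂.trans hr
  obtain ⟨hVt, hVl⟩ := h1 hr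
  have hV0 : 0 < V r := lt_of_lt_of_le (ENNReal.ofReal_pos.2 (by positivity)) hVl
  -- Clearing the denominator in `[0, ∞]` requires it to be neither `0` nor `∞`, hence both halves
  -- of `hlow`.
  rw [← ENNReal.div_le_iff]
  · exact h2 hr
  · exact mul_ne_zero (ENNReal.ofReal_pos.2 (by positivity)).ne' (ENNReal.rpow_pos hV0 hVt).ne'
  · exact ENNReal.mul_ne_top ENNReal.ofReal_ne_top (ENNReal.rpow_ne_top_of_ne_zero hV0.ne' hVt)

theorem mainTheorem4 (N : ℕ) (p : ℝ) (hp : 1 < p) (hpN : p < N)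
    (V : ℝ → ℝ≥0∞) (K : ℝ → ℝ) (hV : ConditionV V) (hK : ConditionK K)
    (R₂ : ℝ) (hR₂ : 0 < R₂)
    (hVfin : ∀ᵐ r ∂(volume.restrict (Set.Ioi R₂)), V r < ⊤)
    (α β γ : ℝ) (hβ₀ : 0 ≤ β) (hβ₁ : β ≤ 1)
    (hratio : essSup (fun r : ℝ => ENNReal.ofReal (K r) / (ENNReal.ofReal (r ^ α) * V r ^ β))
      (volume.restrict (Set.Ioi R₂)) < ⊤)
    (hγ : γ ≤ p)
    (hgrowth : 0 < essInf (fun r : ℝ => ENNReal.ofReal (r ^ γ) * V r)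
      (volume.restrict (Set.Ioi R₂))) :
    (∀ q₂ : ℝ,
      max (max 1 (p * β)) (max (qLowerStar N p α β γ) (qLowerStarStar N p α β γ)) < q₂ →
      Tendsto (fun R : ℝ => RInfty N p V K q₂ R) atTop (𝓝 0)) ∧
    (γ < p →
      (α ≤ alphaUpperStar N p β →
        max (max 1 (p * β)) (max (qLowerStar N p α β γ) (qLowerStarStar N p α β γ)) =
          max (max 1 (p * β)) (qUpperStar N p α β)) ∧
      (alphaUpperStar N p β < α →
        max (max 1 (p * β)) (max (qLowerStar N p α β γ) (qLowerStarStar N p α β γ)) <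
          max (max 1 (p * β)) (qUpperStar N p α β))) := by
  have : NeZero N := ⟨by
    rintro rfl
    norm_num at hpN
    linarith⟩
  refine ⟨fun q hq => ?_, fun hγp => ⟨fun hα => max_qLowerStar_eq hp hpN hγp hβ₁ hα,
    fun hα => max_qLowerStar_lt hp hpN hγp hβ₁ hα⟩⟩
  simp only [max_lt_iff] at hq
  obtain ⟨⟨hq1, hβq⟩, hq2, hq3⟩ := hq
  obtain ⟨b, hb, hlow⟩ := exists_potential_lower_bound hR₂ hVfin hgrowth
  have hK' := ae_le_essSup_div_mul (K := K) (α := α) (β := β) hR₂ hb hlow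
  rcases le_or_gt p q with hpq | hqp
  · exact tendsto_RInfty_of_le_exponent hp hpN hV hR₂ hb hβ₁ hγ hratio.ne hlow hK' hpq hq3
  · exact tendsto_RInfty_of_exponent_lt hp hpN hV hR₂ hb hγ hratio.ne hlow hK' hqp hq1 hβq hq2
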